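/- Let $\Gamma$ be a compact connected metric graph: a finite connected graph with vertex set $V$ and non-empty edge set $E$, without loops or multiple edges, each edge ${\bf e}$ being oriented from an initial vertex ${\rm i}_{\bf e}$ to a terminal vertex ${\rm f}_{\bf e}$ and identified with an interval $[0,\ell_{\bf e}]$, $0<\ell_{\bf e}<\infty$. Put $\ell(\Gamma)=\sum_{\bf e}\ell_{\bf e}$; for measurable $A\subset\Gamma$ let $\ell(A)$ be the sum over the edges of the Lebesgue measure of the part of $A$ on that edge. A function $u$ on $\Gamma$ is a collection of functions $[u]_{\bf e}$ on $(0,\ell_{\bf e})$, $\int_\Gamma u\,dx=\sum_{\bf e}\int_0^{\ell_{\bf e}}[u]_{\bf e}\,dx$, and $u\in BV(\Gamma)$ means $[u]_{\bf e}\in BV(0,\ell_{\bf e})$ for every ${\bf e}$ (no continuity at the vertices is required). Let $X_K(\Gamma)$ be the set of all ${\bf z}$ with $[{\bf z}]_{\bf e}\in W^{1,2}(0,\ell_{\bf e})$ for every ${\bf e}$ that satisfy the Kirchhoff condition $$\sum_{{\bf e}:\,{\rm f}_{\bf e}={\bf v}}[{\bf z}]_{\bf e}(\ell_{\bf e})-\sum_{{\bf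 e}:\,{\rm i}_{\bf e}={\bf v}}[{\bf z}]_{\bf e}(0)=0\qquad\text{for all }{\bf v}\in V .$$ Define $$TV_\Gamma(u)=\sup\Big\{\Big|\int_\Gamma u\,{\bf z}'\,dx\Big| : {\bf z}\in X_K(\Gamma),\ \|{\bf z}\|_{L^\infty(\Gamma)}\le 1\Big\}\in[0,\infty],\qquad {\rm Per}_\Gamma(A)=TV_\Gamma(\chi_A),$$ $$h(\Gamma)=\inf\Big\{\frac{{\rm Per}_\Gamma(D)}{\min\{\ell(D),\ell(\Gamma\setminus D)\}} : D\subset\Gamma \text{ measurable},\ 0<\ell(D)<\ell(\Gamma)\Big\},$$ $$\lambda_1(\Gamma)=\inf\{TV_\Gamma(u) : u\in\Pi(\Gamma)\},\qquad \Pi(\Gamma)=\{u\in BV(\Gamma) : \|u\|_{L^1(\Gamma)}=1,\ 0\in{\rm med}_\ell(u)\},$$ where $0\in{\rm med}_\ell(u)$ means $\ell(\{u<0\})\le\frac12\ell(\Gamma)$ and $\ell(\{u>0\})\le\frac12\ell(\Gamma)$. Let $A\subset\Gamma$ be measurable with $\ell(A)=\frac12\ell(\Gamma)$, and let $u=\frac1{\ell(\Gamma)}\big(\chi_A-\chi_{\Gamma\setminus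 A}\big)$. Then $$h(\Gamma)=\frac{{\rm Per}_\Gamma(A)}{\ell(A)}\iff u\in\Pi(\Gamma)\ \text{ and }\ TV_\Gamma(u)=\lambda_1(\Gamma),$$ that is, if and only if $u$ is a minimizer of the variational problem defining $\lambda_1(\Gamma)$. -/

import Mathlib

open MeasureTheory Set
open scoped ENNReal ContDiff

noncomputable section

/-- A connected metric graph with vertex set `V` and edge set `E`, all of whose edges have finite
length, without loops and without multiple edges. Each edge is oriented from its initial vertex
`init e` to its terminal vertex `term e` and is identified with `[0, len e]`. (It is compact when
`V` and `E` are finite.) -/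
structure MetricGraph (V E : Type*) where
  init : E → V
  term : E → V
  len : E → ℝ
  len_pos : ∀ e, 0 < len e
  no_loops : ∀ e, init e ≠ term e
  no_multiple_edges : ∀ e e', s(init e, term e) = s(init e', term e') → e = e'
  connected : (SimpleGraph.fromRel fun v w => ∃ e, init e = v ∧ term e = w).Connected

namespace MetricGraph

/-- A smooth function with compact support in `(a, b)`. -/
def IsTestFunction (a b : ℝ) (φ : ℝ → ℝ) : Prop :=
  ContDiff ℝ ∞ φ ∧ HasCompactSupport φ ∧ tsupport φ ⊆ Ioo a b

/-- `u ∈ BV(a, b)`: `u` is integrable and its distributional derivative is a finite signed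
measure, written as a difference `μ - ν` of finite positive Borel measures. -/
def MemBVInterval (a b : ℝ) (u : ℝ → ℝ) : Prop :=
  IntegrableOn u (Ioo a b) ∧
    ∃ μ ν : Measure ℝ, IsFiniteMeasure μ ∧ IsFiniteMeasure ν ∧
      ∀ φ, IsTestFunction a b φ →
        ∫ x in Ioo a b, u x * deriv φ x = -(∫ x in Ioo a b, φ x ∂μ - ∫ x in Ioo a b, φ x ∂ν)

/-- `z` is the continuous representative on `[a, b]` of an element of `W^{1,2}(a, b)`, and `z'` is
its weak derivative. -/
def IsSobolevPair (a b : ℝ) (z z' : ℝ → ℝ) : Prop :=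
  ContinuousOn z (Icc a b) ∧
    MemLp z 2 (volume.restrict (Ioo a b)) ∧ MemLp z' 2 (volume.restrict (Ioo a b)) ∧
      ∀ φ, IsTestFunction a b φ →
        ∫ x in Ioo a b, z x * deriv φ x = -∫ x in Ioo a b, z' x * φ x

variable {V E : Type*} (G : MetricGraph V E)

/-- The points of the graph: its vertices and the interior points of its edges. -/
def Point : Type _ := V ⊕ (Σ e : E, Ioo (0 : ℝ) (G.len e))

open Classical in
/-- The point of the edge `e` with coordinate `x ∈ [0, len e]` (extended constantly to `ℝ`). -/
def point (e : E) (x : ℝ) : G.Point :=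
  if h : x ∈ Ioo (0 : ℝ) (G.len e) then Sum.inr ⟨e, ⟨x, h⟩⟩
  else if x ≤ 0 then Sum.inl (G.init e) else Sum.inl (G.term e)

/-- The set `c_e(A ∩ e) ⊆ [0, len e]` of the coordinates of the points of `A` on the edge `e`. -/
def coordSet (A : Set G.Point) (e : E) : Set ℝ :=
  {x | x ∈ Icc 0 (G.len e) ∧ G.point e x ∈ A}

/-- `A` is (Lebesgue) measurable on every edge. -/
def IsMeasurable (A : Set G.Point) : Prop :=
  ∀ e, NullMeasurableSet (G.coordSet A e) volume

/-- A real function on the graph is a collection of functions `u e` on `(0, len e)`; the values of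
`u e` outside of this interval play no role. -/
def Fun (_ : MetricGraph V E) : Type _ := E → ℝ → ℝ

/-- The characteristic function of a set. -/
def char (A : Set G.Point) : G.Fun :=
  fun e => (G.coordSet A e).indicator fun _ => 1

/-- The set `{u > t}`. -/
def superlevel (u : G.Fun) (t : ℝ) : Set G.Point :=
  {p | ∃ e, ∃ x ∈ Ioo (0 : ℝ) (G.len e), p = G.point e x ∧ t < u e x}

/-- The set `{u < t}`. -/
def sublevel (u : G.Fun) (t : ℝ) : Set G.Point :=
  {p | ∃ e, ∃ x ∈ Ioo (0 : ℝ) (G.len e), p = G.point e x ∧ u e x < t}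

/-- `u ∈ BV(Γ)`. -/
def MemBV (u : G.Fun) : Prop :=
  ∀ e, MemBVInterval 0 (G.len e) (u e)

open Classical in
/-- The outward value at the vertex `v` of `z` on an edge `e` incident to `v`. -/
def outward (z : G.Fun) (e : E) (v : V) : ℝ :=
  if v = G.term e then z e (G.len e) else -z e 0

variable [Fintype E]

/-- The total length `ℓ(Γ)`. -/
def totalLength : ℝ := ∑ e, G.len e

/-- The length `ℓ(A)` of a set `A ⊆ Γ`. -/
def length (A : Set G.Point) : ℝ≥0∞ := ∑ e, volume (G.coordSet A e)

theorem length_univ : G.length univ = ENNReal.ofReal G.totalLength := by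
  unfold length totalLength
  rw [ENNReal.ofReal_sum_of_nonneg fun e _ => (G.len_pos e).le]
  refine Finset.sum_congr rfl fun e _ => ?_
  have h : G.coordSet univ e = Icc 0 (G.len e) := by
    ext x
    simp [coordSet]
  rw [h, Real.volume_Icc, sub_zero]

open Classical in
/-- The edges incident to `v`. -/
def incidentEdges (v : V) : Finset E :=
  Finset.univ.filter fun e => G.init e = v ∨ G.term e = v

/-- `z ∈ X_K(Γ)` with weak derivative `z'`: `z` is in `W^{1,2}` on every edge and satisfies the
Kirchhoff condition at every vertex. -/
def MemXK (z z' : G.Fun) : Prop :=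
  (∀ e, IsSobolevPair 0 (G.len e) (z e) (z' e)) ∧
    ∀ v, ∑ e ∈ G.incidentEdges v, G.outward z e v = 0

/-- The total variation `TV_Γ(u)`: the supremum of `|∫_Γ u z'|` over all `z ∈ X_K(Γ)` with
`‖z‖_∞ ≤ 1`. -/
def TV (u : G.Fun) : ℝ≥0∞ :=
  ⨆ (z : G.Fun) (z' : G.Fun) (_ : G.MemXK z z')
    (_ : ∀ e, eLpNorm (z e) ∞ (volume.restrict (Ioo 0 (G.len e))) ≤ 1),
    ENNReal.ofReal |∑ e, ∫ x in Ioo 0 (G.len e), u e x * z' e x|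

/-- The perimeter `Per_Γ(A)`. -/
def Per (A : Set G.Point) : ℝ≥0∞ := G.TV (G.char A)

/-- The Cheeger constant `h(Γ)`. -/
def cheeger : ℝ≥0∞ :=
  ⨅ (D : Set G.Point) (_ : G.IsMeasurable D) (_ : 0 < G.length D)
    (_ : G.length D < ENNReal.ofReal G.totalLength), G.Per D / min (G.length D) (G.length Dᶜ)

/-- The norm of `L¹(Γ)`. -/
def normL1 (u : G.Fun) : ℝ≥0∞ :=
  ∑ e, eLpNorm (u e) 1 (volume.restrict (Ioo 0 (G.len e)))

/-- `m` is a median of `u`. -/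
def IsMedian (u : G.Fun) (m : ℝ) : Prop :=
  G.length (G.sublevel u m) ≤ ENNReal.ofReal (G.totalLength / 2) ∧
    G.length (G.superlevel u m) ≤ ENNReal.ofReal (G.totalLength / 2)

/-- The admissible class `Π(Γ)`. -/
def admissible : Set G.Fun :=
  {u | G.MemBV u ∧ G.normL1 u = 1 ∧ G.IsMedian u 0}

/-- `λ₁(Γ)`, the infimum of the total variation over `Π(Γ)`. -/
def lambda1 : ℝ≥0∞ := ⨅ u ∈ G.admissible, G.TV u

/-- `u` is a minimizer of the variational problem for `λ₁(Γ)`. -/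
def IsMinimizer (u : G.Fun) : Prop :=
  u ∈ G.admissible ∧ G.TV u = G.lambda1

/-- The function `(χ_A - χ_{Γ ∖ A}) / ℓ(Γ)`. -/
def cutFun (A : Set G.Point) : G.Fun :=
  fun e x => 1 / G.totalLength * (G.char A e x - G.char Aᶜ e x)

end MetricGraph

end

/-! The heart of the matter is the identity λ₁(Γ) = h(Γ). Since ℓ(A) = ℓ(Γ)/2 and every Kirchhoff
field satisfies ∫ z' = 0, the cut function has TV_Γ(u) = (2/ℓ(Γ)) Per(A) = Per(A)/ℓ(A), so both
sides of the equivalence say that this number equals h(Γ) = λ₁(Γ). Membership in Π(Γ) comes with it: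
h(Γ) is finite, and an integrable function of finite TV is BV on every edge (`memBV_of_TV_ne_top`).

The bound λ₁ ≤ h (`lambda1_le_cheeger`) comes from χ_D/ℓ(D), where D is the smaller of a set and its
complement.

The bound h ≤ λ₁ (`cheeger_le_TV`) replaces a coarea formula by a finite one. Each edge is cut into
n equal cells and u is replaced by its cell means. A Kirchhoff field, seen at the division points,
is a choice of outward values in [-1,1] at the ends of the cells, with sum zero at each point. One
such choice is optimal for all superlevel sets of the cell means at once
(`exists_optimal_on_superlevels`): at each point, pair the largest values with the smallest. Its sum
over the ends above level t bounds the perimeter of that superlevel set from above, hence is at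
least h times the smaller of the two lengths. Integrating in t gives a Poincaré inequality for the
cell means around a weighted median c (`exists_ofReal_mul_sum_abs_le_TV`). As n grows the cell means
approach u in L¹, and because 0 is a median of u, ∫|u - c| ≥ ∫|u| = 1. -/

noncomputable section

/-! ### Test functions and W^{1,2} functions on an interval. -/

namespace MetricGraph

theorem IsTestFunction.eq_zero_of_notMem {a b : ℝ} {φ : ℝ → ℝ} (h : IsTestFunction a b φ) {x : ℝ}
    (hx : x ∉ Ioo a b) : φ x = 0 :=
  image_eq_zero_of_notMem_tsupport fun hx' => hx (h.2.2 hx')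

theorem IsTestFunction.continuous {a b : ℝ} {φ : ℝ → ℝ} (h : IsTestFunction a b φ) :
    Continuous φ := h.1.continuous

theorem IsTestFunction.continuous_deriv {a b : ℝ} {φ : ℝ → ℝ} (h : IsTestFunction a b φ) :
    Continuous (deriv φ) := h.1.continuous_deriv (by simp)

theorem IsTestFunction.integral_eq {a b : ℝ} {φ : ℝ → ℝ} (h : IsTestFunction a b φ)
    (u : ℝ → ℝ) : ∫ x in Ioo a b, u x * φ x = ∫ x, u x * φ x :=
  setIntegral_eq_integral_of_forall_compl_eq_zero fun x hx => by simp [h.eq_zero_of_notMem hx]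

theorem integral_primitive_mul_deriv {L : ℝ} (hL : 0 < L) {g φ : ℝ → ℝ}
    (hg : IntegrableOn g (Ioo 0 L)) (hφ : IsTestFunction 0 L φ) :
    ∫ x in Ioo 0 L, (∫ t in 0..x, g t) * deriv φ x = -∫ x in Ioo 0 L, g x * φ x := by
  have hgi : IntervalIntegrable g volume 0 L := by
    rwa [intervalIntegrable_iff_integrableOn_Ioo_of_le hL.le]
  have hac := hgi.absolutelyContinuousOnInterval_intervalIntegral (c := 0) (by simp)
  have hφac : AbsolutelyContinuousOnInterval φ 0 L :=
    (hφ.1.of_le (by simp)).contDiffOn.absolutelyContinuousOnInterval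
  have key := hac.integral_mul_deriv_eq_deriv_mul hφac
  rw [← integral_Ioc_eq_integral_Ioo, ← integral_Ioc_eq_integral_Ioo,
    ← intervalIntegral.integral_of_le hL.le, ← intervalIntegral.integral_of_le hL.le, key,
    hφ.eq_zero_of_notMem (x := L) (by simp)]
  simp only [mul_zero, intervalIntegral.integral_same, zero_mul, sub_zero, zero_sub, neg_inj]
  refine intervalIntegral.integral_congr_ae ?_
  filter_upwards [hgi.ae_hasDerivAt_integral] with x hx hx'
  rw [(hx (uIoc_subset_uIcc hx') 0 (by simp)).deriv]

theorem integrableOn_of_memLp_two {a b : ℝ} {g : ℝ → ℝ}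
    (hg : MemLp g 2 (volume.restrict (Ioo a b))) : IntegrableOn g (Ioo a b) :=
  hg.integrable (by norm_num)

theorem continuousOn_primitive {L : ℝ} (hL : 0 < L) {g : ℝ → ℝ}
    (hg : IntegrableOn g (Ioo 0 L)) : ContinuousOn (fun x => ∫ t in 0..x, g t) (Icc 0 L) := by
  have := intervalIntegral.continuousOn_primitive_interval (f := g) (μ := volume) (a := 0) (b := L)
    (by rw [uIcc_of_le hL.le]; rwa [integrableOn_Icc_iff_integrableOn_Ioo])
  rwa [uIcc_of_le hL.le] at this

theorem memLp_of_continuousOn {a b : ℝ} {z : ℝ → ℝ} (hz : ContinuousOn z (Icc a b)) (p : ℝ≥0∞) :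
    MemLp z p (volume.restrict (Ioo a b)) := by
  obtain ⟨C, hC⟩ := isCompact_Icc.exists_bound_of_continuousOn hz
  exact MemLp.of_bound ((hz.mono Ioo_subset_Icc_self).aestronglyMeasurable measurableSet_Ioo) C
    ((ae_restrict_mem measurableSet_Ioo).mono fun x hx => hC x (Ioo_subset_Icc_self hx))

theorem integrableOn_mul_of_continuous {a b : ℝ} {g φ : ℝ → ℝ} (hg : IntegrableOn g (Ioo a b))
    (hφ : Continuous φ) : IntegrableOn (fun x => g x * φ x) (Ioo a b) := by
  obtain ⟨C, hC⟩ := (isCompact_Icc (a := a) (b := b)).exists_bound_of_continuousOn hφ.continuousOn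
  exact Integrable.mul_bdd (c := C) hg hφ.aestronglyMeasurable
    ((ae_restrict_mem measurableSet_Ioo).mono fun x hx => hC x (Ioo_subset_Icc_self hx))

theorem isSobolevPair_primitive {L : ℝ} (hL : 0 < L) {g : ℝ → ℝ}
    (hg : MemLp g 2 (volume.restrict (Ioo 0 L))) (c : ℝ) :
    IsSobolevPair 0 L (fun x => c + ∫ t in 0..x, g t) g := by
  have hgi := integrableOn_of_memLp_two hg
  have hc : ContinuousOn (fun x => c + ∫ t in 0..x, g t) (Icc 0 L) :=
    continuousOn_const.add (continuousOn_primitive hL hgi)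
  refine ⟨hc, memLp_of_continuousOn hc 2, hg, fun φ hφ => ?_⟩
  have h1 : ∫ x in Ioo 0 L, deriv φ x = 0 := by
    rw [← integral_Ioc_eq_integral_Ioo, ← intervalIntegral.integral_of_le hL.le,
      intervalIntegral.integral_deriv_eq_sub (fun x _ => hφ.1.differentiable (by simp) x)
        (hφ.continuous_deriv.intervalIntegrable _ _), hφ.eq_zero_of_notMem (x := L) (by simp),
      hφ.eq_zero_of_notMem (x := 0) (by simp), sub_zero]
  have h2 : IntegrableOn (fun x => c * deriv φ x) (Ioo 0 L) :=
    (hφ.continuous_deriv.const_mul c |>.integrableOn_Icc).mono_set Ioo_subset_Icc_self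
  have h3 : IntegrableOn (fun x => (∫ t in 0..x, g t) * deriv φ x) (Ioo 0 L) :=
    ((continuousOn_primitive hL hgi).mul hφ.continuous_deriv.continuousOn |>.integrableOn_Icc
      ).mono_set Ioo_subset_Icc_self
  simp only [add_mul]
  rw [integral_add h2 h3, integral_const_mul, h1, mul_zero, zero_add,
    integral_primitive_mul_deriv hL hgi hφ]

theorem exists_isTestFunction_integral_eq_one {L : ℝ} (hL : 0 < L) :
    ∃ ψ, IsTestFunction 0 L ψ ∧ ∫ x, ψ x = 1 := by
  let f : ContDiffBump (L / 2) := ⟨L / 8, L / 4, by positivity, by linarith⟩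
  refine ⟨f.normed volume, ⟨f.contDiff_normed, f.hasCompactSupport_normed, ?_⟩, f.integral_normed⟩
  rw [f.tsupport_normed_eq]
  intro x hx
  rw [Metric.mem_closedBall, Real.dist_eq, abs_le] at hx
  change -(L / 4) ≤ _ ∧ _ ≤ L / 4 at hx
  constructor <;> linarith [hx.1, hx.2]

theorem isTestFunction_primitive {L : ℝ} {ψ : ℝ → ℝ} (hψ : IsTestFunction 0 L ψ)
    (h0 : ∫ x, ψ x = 0) :
    IsTestFunction 0 L (fun x => ∫ t in 0..x, ψ t) ∧ deriv (fun x => ∫ t in 0..x, ψ t) = ψ := by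
  have hd : ∀ x, HasDerivAt (fun x => ∫ t in 0..x, ψ t) (ψ x) x := fun x =>
    hψ.continuous.integral_hasStrictDerivAt 0 x |>.hasDerivAt
  have hderiv : deriv (fun x => ∫ t in 0..x, ψ t) = ψ := funext fun x => (hd x).deriv
  obtain ⟨a, b, ha, hb, hab⟩ : ∃ a b, 0 < a ∧ b < L ∧ ∀ x ∉ Icc a b, ψ x = 0 := by
    rcases (tsupport ψ).eq_empty_or_nonempty with he | hne
    -- With empty support any bounds with 0 < a and b < L will do.
    · refine ⟨1, L - 1, one_pos, by linarith, fun x _ => image_eq_zero_of_notMem_tsupport ?_⟩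
      simp [he]
    · obtain ⟨a, ha⟩ := hψ.2.1.isCompact.exists_isLeast hne
      obtain ⟨b, hb⟩ := hψ.2.1.isCompact.exists_isGreatest hne
      exact ⟨a, b, (hψ.2.2 ha.1).1, (hψ.2.2 hb.1).2, fun x hx =>
        image_eq_zero_of_notMem_tsupport fun h => hx ⟨ha.2 h, hb.2 h⟩⟩
  have hz : ∀ x ∉ Icc a b, ∫ t in 0..x, ψ t = 0 := by
    intro x hx
    rcases lt_or_ge x a with h | h
    · rw [intervalIntegral.integral_congr (g := fun _ => 0), intervalIntegral.integral_zero]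
      intro t ht
      refine hab t fun ht' => ?_
      rcases le_total 0 x with h0x | h0x
      · rw [uIcc_of_le h0x] at ht; linarith [ht.2, ht'.1]
      · rw [uIcc_of_ge h0x] at ht; linarith [ht.2, ht'.1]
    · have hbx : b < x := not_le.1 fun h' => hx ⟨h, h'⟩
      have h0x : 0 ≤ x := by linarith
      rw [intervalIntegral.integral_of_le h0x,
        setIntegral_eq_integral_of_forall_compl_eq_zero, h0]
      intro t ht
      refine hab t fun ht' => ht ⟨by linarith [ht'.1], by linarith [ht'.2]⟩
  have hts : tsupport (fun x => ∫ t in 0..x, ψ t) ⊆ Icc a b :=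
    closure_minimal (fun x hx => by_contra fun h => hx (hz x h)) isClosed_Icc
  refine ⟨⟨?_, ?_, ?_⟩, hderiv⟩
  · refine contDiff_infty_iff_deriv.2 ⟨fun x => (hd x).differentiableAt, ?_⟩
    rw [hderiv]; exact hψ.1
  · exact isCompact_Icc.of_isClosed_subset (isClosed_tsupport _) hts
  · exact fun x hx => ⟨ha.trans_le (hts hx).1, (hts hx).2.trans_lt hb⟩

/-- The du Bois-Reymond argument: for a fixed bump ψ₀ of integral 1 and any test function ψ, the
difference ψ - (∫ψ) ψ₀ has integral zero, hence is the derivative of a test function. So w - ∫ w ψ₀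
is orthogonal to every ψ and vanishes almost everywhere; continuity extends this to the closed
interval. -/
theorem eq_const_of_integral_mul_deriv_eq_zero {L : ℝ} (hL : 0 < L) {w : ℝ → ℝ}
    (hw : ContinuousOn w (Icc 0 L))
    (h : ∀ φ, IsTestFunction 0 L φ → ∫ x in Ioo 0 L, w x * deriv φ x = 0) :
    ∃ c, ∀ x ∈ Icc 0 L, w x = c := by
  obtain ⟨ψ₀, hψ₀, h1⟩ := exists_isTestFunction_integral_eq_one hL
  have hwi : IntegrableOn w (Ioo 0 L) := hw.integrableOn_Icc.mono_set Ioo_subset_Icc_self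
  set c := ∫ x in Ioo 0 L, w x * ψ₀ x with hc
  refine ⟨c, ?_⟩
  have hae : ∀ᵐ x, x ∈ Ioo 0 L → w x - c = 0 := by
    refine isOpen_Ioo.ae_eq_zero_of_integral_contDiff_smul_eq_zero
      (IntegrableOn.locallyIntegrableOn (hwi.sub (by simp))) fun ψ h1ψ h2ψ h3ψ => ?_
    have hψ : IsTestFunction 0 L ψ := ⟨h1ψ, h2ψ, h3ψ⟩
    set I := ∫ x, ψ x with hI
    have hθ : IsTestFunction 0 L (fun x => ψ x - I * ψ₀ x) := by
      refine ⟨hψ.1.sub (contDiff_const.mul hψ₀.1), hψ.2.1.sub (hψ₀.2.1.mul_left), ?_⟩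
      refine (tsupport_sub ψ _).trans (union_subset hψ.2.2 ?_)
      exact (tsupport_mul_subset_right).trans hψ₀.2.2
    have hψi : Integrable ψ := hψ.continuous.integrable_of_hasCompactSupport hψ.2.1
    have hψ₀i : Integrable ψ₀ := hψ₀.continuous.integrable_of_hasCompactSupport hψ₀.2.1
    have h0 : ∫ x, (ψ x - I * ψ₀ x) = 0 := by
      rw [integral_sub hψi (hψ₀i.const_mul I), integral_const_mul, h1, mul_one, sub_self]
    obtain ⟨hΦ, hd⟩ := isTestFunction_primitive hθ h0
    have hz := h _ hΦ
    rw [hd] at hz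
    have e1 := integrableOn_mul_of_continuous hwi hψ.continuous
    have e2 := integrableOn_mul_of_continuous hwi hψ₀.continuous
    have : ∫ x in Ioo 0 L, w x * (ψ x - I * ψ₀ x) = (∫ x in Ioo 0 L, w x * ψ x) - I * c := by
      rw [hc, ← integral_const_mul, ← integral_sub e1 (e2.const_mul I)]
      exact integral_congr_ae (.of_forall fun x => by ring)
    rw [this] at hz
    have h4 : ∫ x, ψ x • (w x - c) = ∫ x in Ioo 0 L, (w x - c) * ψ x := by
      rw [hψ.integral_eq]
      exact integral_congr_ae (.of_forall fun x => by simp [mul_comm])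
    have h5 : ∫ x in Ioo 0 L, ψ x = I := by
      have := hψ.integral_eq fun _ => 1
      simpa using this
    rw [h4]
    simp only [sub_mul]
    rw [integral_sub e1 (hψi.const_mul c).integrableOn, integral_const_mul, h5]
    linarith
  have hae' : w =ᵐ[volume.restrict (Icc 0 L)] fun _ => c := by
    rw [← restrict_Ioo_eq_restrict_Icc]
    exact (ae_restrict_iff' measurableSet_Ioo).2 (hae.mono fun x hx hx' => sub_eq_zero.1 (hx hx'))
  exact Measure.eqOn_Icc_of_ae_eq volume hL.ne hae' hw continuousOn_const

/-- This ties the end values in the Kirchhoff condition to the weak derivative, which is all that TV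
sees. -/
theorem IsSobolevPair.eq_primitive {L : ℝ} (hL : 0 < L) {z z' : ℝ → ℝ}
    (h : IsSobolevPair 0 L z z') {x : ℝ} (hx : x ∈ Icc 0 L) :
    z x = z 0 + ∫ t in 0..x, z' t := by
  obtain ⟨hz, -, hz', hweak⟩ := h
  have hi := integrableOn_of_memLp_two hz'
  obtain ⟨c, hc⟩ := eq_const_of_integral_mul_deriv_eq_zero hL
    (w := fun x => z x - ∫ t in 0..x, z' t) (hz.sub (continuousOn_primitive hL hi)) fun φ hφ => by
      have e1 : IntegrableOn (fun x => z x * deriv φ x) (Ioo 0 L) :=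
        (hz.mul hφ.continuous_deriv.continuousOn).integrableOn_Icc.mono_set Ioo_subset_Icc_self
      have e2 : IntegrableOn (fun x => (∫ t in 0..x, z' t) * deriv φ x) (Ioo 0 L) :=
        ((continuousOn_primitive hL hi).mul hφ.continuous_deriv.continuousOn
          ).integrableOn_Icc.mono_set Ioo_subset_Icc_self
      simp only [sub_mul]
      rw [integral_sub e1 e2, hweak φ hφ, integral_primitive_mul_deriv hL hi hφ, sub_self]
  have h0 := hc 0 ⟨le_rfl, hL.le⟩
  have h1 := hc x hx
  simp only [intervalIntegral.integral_same, sub_zero] at h0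
  linarith

theorem IsSobolevPair.sub_eq_integral {L : ℝ} (hL : 0 < L) {z z' : ℝ → ℝ}
    (h : IsSobolevPair 0 L z z') {x y : ℝ} (hx : 0 ≤ x) (hxy : x ≤ y) (hy : y ≤ L) :
    z y - z x = ∫ t in Ioc x y, z' t := by
  have hi := integrableOn_of_memLp_two h.2.2.1
  have hI : ∀ {a}, 0 ≤ a → a ≤ L → IntervalIntegrable z' volume 0 a := fun h0 h1 => by
    rw [intervalIntegrable_iff_integrableOn_Ioo_of_le h0]
    exact hi.mono_set (Ioo_subset_Ioo_right h1)
  rw [h.eq_primitive hL ⟨hx, hxy.trans hy⟩, h.eq_primitive hL ⟨hx.trans hxy, hy⟩,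
    add_sub_add_left_eq_sub, intervalIntegral.integral_interval_sub_left
      (hI (hx.trans hxy) hy) (hI hx (hxy.trans hy)), intervalIntegral.integral_of_le hxy]

theorem abs_le_one_of_eLpNorm_le {L : ℝ} (hL : 0 < L) {z : ℝ → ℝ}
    (hz : ContinuousOn z (Icc 0 L)) (h : eLpNorm z ∞ (volume.restrict (Ioo 0 L)) ≤ 1)
    {x : ℝ} (hx : x ∈ Icc 0 L) : |z x| ≤ 1 := by
  have hae : ∀ᵐ x ∂(volume.restrict (Ioo 0 L)), |z x| ≤ 1 := by
    rw [eLpNorm_exponent_top] at h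
    filter_upwards [ae_le_eLpNormEssSup (f := z) (μ := volume.restrict (Ioo 0 L))] with x hx
    have := hx.trans h
    rwa [Real.enorm_eq_ofReal_abs, ENNReal.ofReal_le_one] at this
  -- The almost-everywhere bound becomes an equality of continuous functions, which then holds at
  -- the end points too.
  have hae' : (fun x => max |z x| 1) =ᵐ[volume.restrict (Icc 0 L)] fun _ => 1 := by
    rw [← restrict_Ioo_eq_restrict_Icc]
    exact hae.mono fun x hx => max_eq_right hx
  have := Measure.eqOn_Icc_of_ae_eq volume hL.ne hae'
    ((continuous_abs.comp_continuousOn hz).sup continuousOn_const) continuousOn_const hx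
  exact max_eq_right_iff.1 this

end MetricGraph

/-! ### Test fields built from ramps. -/

namespace MetricGraph

/-- By Abel summation the expression is a convex combination of the ζ k, with weights 1 - r 0, r 0 -
r 1, …, r (n - 1). This covers ramps that overlap. -/
theorem abs_add_sum_sub_mul_le_one {n : ℕ} {ζ r : ℕ → ℝ} (hζ : ∀ k ≤ n, |ζ k| ≤ 1)
    (hr : ∀ k, k + 1 < n → r (k + 1) ≤ r k) (hr0 : ∀ k < n, 0 ≤ r k) (hr1 : ∀ k < n, r k ≤ 1) :
    |ζ 0 + ∑ k ∈ Finset.range n, (ζ (k + 1) - ζ k) * r k| ≤ 1 := by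
  suffices h : ∀ m, m < n → |ζ 0 + ∑ k ∈ Finset.range (m + 1), (ζ (k + 1) - ζ k) * r k
      - ζ (m + 1) * r m| ≤ 1 - r m by
    rcases n with _ | m
    · simpa using hζ 0 le_rfl
    · have h1 := h m (by omega)
      have h2 := hζ (m + 1) le_rfl
      have h3 := hr0 m (by omega)
      have h4 : |ζ (m + 1) * r m| ≤ r m := by
        rw [abs_mul, abs_of_nonneg h3]; exact mul_le_of_le_one_left h3 h2
      rw [abs_le] at *
      constructor <;> linarith [h1.1, h1.2, h4.1, h4.2]
  intro m
  induction m with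
  | zero =>
    intro hm
    have h3 := hr1 0 hm
    have : ζ 0 + ∑ k ∈ Finset.range (0 + 1), (ζ (k + 1) - ζ k) * r k - ζ (0 + 1) * r 0
        = ζ 0 * (1 - r 0) := by simp; ring
    rw [this, abs_mul, abs_of_nonneg (sub_nonneg.2 h3)]
    exact mul_le_of_le_one_left (sub_nonneg.2 h3) (hζ 0 (by omega))
  | succ m ih =>
    intro hm
    have h1 := ih (by omega)
    have h2 := hr m hm
    have h4 : |ζ (m + 1) * (r m - r (m + 1))| ≤ r m - r (m + 1) := by
      rw [abs_mul, abs_of_nonneg (sub_nonneg.2 h2)]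
      exact mul_le_of_le_one_left (sub_nonneg.2 h2) (hζ _ (by omega))
    rw [Finset.sum_range_succ]
    rw [abs_le] at *
    constructor <;> nlinarith [h1.1, h1.2, h4.1, h4.2]

theorem integral_indicator_Ioc {x δ y : ℝ} (hx : 0 ≤ x) (hy : 0 ≤ y) :
    ∫ t in 0..y, (Ioc x (x + δ)).indicator (fun _ => (1 : ℝ)) t = max (min y (x + δ) - x) 0 := by
  rw [intervalIntegral.integral_of_le hy, setIntegral_indicator measurableSet_Ioc,
    Ioc_inter_Ioc, max_eq_right hx, setIntegral_const, smul_eq_mul, mul_one, Measure.real,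
    Real.volume_Ioc, ENNReal.toReal_ofReal']

/-- The test field on `[0, L]` that starts at the value `ζ 0` and moves linearly from `ζ k` to
`ζ (k + 1)` over `[x k, x k + δ]`. -/
theorem exists_isSobolevPair_step {L : ℝ} (hL : 0 < L) {n : ℕ} {x ζ : ℕ → ℝ} {δ : ℝ} (hδ : 0 < δ)
    (hx : ∀ k, k + 1 < n → x k ≤ x (k + 1)) (hx0 : ∀ k < n, 0 ≤ x k)
    (hxL : ∀ k < n, x k + δ ≤ L) (hζ : ∀ k ≤ n, |ζ k| ≤ 1) :
    ∃ z z' : ℝ → ℝ, IsSobolevPair 0 L z z' ∧ z 0 = ζ 0 ∧ z L = ζ n ∧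
      (∀ y ∈ Icc 0 L, |z y| ≤ 1) ∧
      ∀ u : ℝ → ℝ, IntegrableOn u (Ioo 0 L) →
        ∫ y in Ioo 0 L, u y * z' y =
          ∑ k ∈ Finset.range n, (ζ (k + 1) - ζ k) * (δ⁻¹ * ∫ y in Ioc (x k) (x k + δ), u y) := by
  let ρ : ℕ → ℝ → ℝ := fun k => (Ioc (x k) (x k + δ)).indicator fun _ => (1 : ℝ)
  let g : ℝ → ℝ := fun y => ∑ k ∈ Finset.range n, (ζ (k + 1) - ζ k) * δ⁻¹ * ρ k y
  have hρ2 : ∀ k, MemLp (ρ k) 2 (volume.restrict (Ioo 0 L)) := fun k =>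
    (memLp_const 1).indicator measurableSet_Ioc
  have hg2 : MemLp g 2 (volume.restrict (Ioo 0 L)) :=
    memLp_finsetSum _ fun k _ => (hρ2 k).const_mul _
  have hz : ∀ y, 0 ≤ y → ζ 0 + ∫ t in 0..y, g t = ζ 0 + ∑ k ∈ Finset.range n,
      (ζ (k + 1) - ζ k) * (δ⁻¹ * max (min y (x k + δ) - x k) 0) := by
    intro y hy
    rw [intervalIntegral.integral_finsetSum]
    · congr 1
      refine Finset.sum_congr rfl fun k hk => ?_
      rw [intervalIntegral.integral_const_mul,
        integral_indicator_Ioc (hx0 k (Finset.mem_range.1 hk)) hy, mul_assoc]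
    · intro k _
      refine IntervalIntegrable.const_mul ?_ _
      rw [intervalIntegrable_iff]
      exact (integrable_indicator_iff measurableSet_Ioc).2 (by simp) |>.integrableOn
  refine ⟨_, g, isSobolevPair_primitive hL hg2 (ζ 0), by simp, ?_, ?_, ?_⟩
  · rw [hz L hL.le]
    have : ∀ k ∈ Finset.range n, (ζ (k + 1) - ζ k) * (δ⁻¹ * max (min L (x k + δ) - x k) 0)
        = ζ (k + 1) - ζ k := by
      intro k hk
      rw [min_eq_right (hxL k (Finset.mem_range.1 hk)), add_sub_cancel_left, max_eq_left hδ.le,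
        inv_mul_cancel₀ hδ.ne', mul_one]
    rw [Finset.sum_congr rfl this, Finset.sum_range_sub]
    ring
  · intro y hy
    simp only [hz y hy.1]
    refine abs_add_sum_sub_mul_le_one hζ (fun k hk => ?_) (fun k hk => by positivity) fun k hk => ?_
    · have := hx k hk
      refine mul_le_mul_of_nonneg_left (max_le_max_right 0 ?_) (by positivity)
      simp only [min_def]
      split_ifs <;> linarith
    · rw [inv_mul_le_iff₀ hδ, mul_one]
      exact max_le (by linarith [min_le_right y (x k + δ)]) hδ.le
  · intro u hu
    have e : ∀ y, u y * g y = ∑ k ∈ Finset.range n,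
        (ζ (k + 1) - ζ k) * (δ⁻¹ * (Ioc (x k) (x k + δ)).indicator u y) := by
      intro y
      simp only [g, ρ, Finset.mul_sum]
      refine Finset.sum_congr rfl fun k _ => ?_
      by_cases h : y ∈ Ioc (x k) (x k + δ) <;> simp [h]
      ring
    simp only [e]
    rw [← integrableOn_Ioc_iff_integrableOn_Ioo] at hu
    rw [← integral_Ioc_eq_integral_Ioo, integral_finsetSum]
    · refine Finset.sum_congr rfl fun k hk => ?_
      have hk := Finset.mem_range.1 hk
      rw [integral_const_mul, integral_const_mul, setIntegral_indicator measurableSet_Ioc,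
        Ioc_inter_Ioc, max_eq_right (hx0 k hk), min_eq_right (hxL k hk)]
    · intro k _
      exact ((hu.indicator measurableSet_Ioc).const_mul _).const_mul _

end MetricGraph

/-! ### Finite total variation implies BV on every edge. -/

namespace MetricGraph

theorem sum_range_succ_sub_mul (ζ a : ℕ → ℝ) (m : ℕ) :
    ∑ k ∈ Finset.range (m + 1), (ζ (k + 1) - ζ k) * a k =
      ζ (m + 1) * a m - ζ 0 * a 0 - ∑ k ∈ Finset.range m, ζ (k + 1) * (a (k + 1) - a k) := by
  induction m with
  | zero => simp; ring
  | succ m ih => rw [Finset.sum_range_succ, ih, Finset.sum_range_succ _ m]; ring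

/-- Integration by parts against a Stieltjes measure. -/
theorem integral_stieltjes_mul_deriv {L : ℝ} (hL : 0 < L) (f : StieltjesFunction ℝ) {φ : ℝ → ℝ}
    (hφ : IsTestFunction 0 L φ) :
    ∫ x in Ioo 0 L, f x * deriv φ x = -∫ x in Ioo 0 L, φ x ∂f.measure := by
  have hfin : IsFiniteMeasure (f.measure.restrict (Ioc 0 L)) :=
    ⟨by simp [f.measure_Ioc]⟩
  have hdiff : Differentiable ℝ φ := hφ.1.differentiable (by simp)
  have hI : ∀ a b, ∫ y in a..b, deriv φ y = φ b - φ a := fun a b =>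
    intervalIntegral.integral_deriv_eq_sub (fun x _ => hdiff x)
      (hφ.continuous_deriv.intervalIntegrable _ _)
  have hφL : φ L = 0 := hφ.eq_zero_of_notMem (by simp)
  have hφ0 : φ 0 = 0 := hφ.eq_zero_of_notMem (by simp)
  have h1 : ∫ x in Ioo 0 L, φ x ∂f.measure = ∫ x in Ioc 0 L, φ x ∂f.measure := by
    refine (setIntegral_eq_of_subset_of_forall_sdiff_eq_zero measurableSet_Ioc
      Ioo_subset_Ioc_self fun x hx => hφ.eq_zero_of_notMem hx.2).symm
  -- Writing φ(x) as minus the integral of φ' over [x, L] turns the claim into an exchange of two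
  -- integrals.
  have h2 : ∀ x ∈ Ioc 0 L, φ x = -∫ y in Ioc 0 L, (Ici x).indicator (deriv φ) y := by
    intro x hx
    have : Ioc 0 L ∩ Ici x = Icc x L := by
      ext y; simp only [mem_inter_iff, mem_Ioc, mem_Ici, mem_Icc]
      exact ⟨fun h => ⟨h.2, h.1.2⟩, fun h => ⟨⟨hx.1.trans_le h.1, h.2⟩, h.1⟩⟩
    rw [setIntegral_indicator measurableSet_Ici, this, integral_Icc_eq_integral_Ioc,
      ← intervalIntegral.integral_of_le hx.2, hI, hφL]
    ring
  obtain ⟨C, hC⟩ := (isCompact_Icc (a := (0 : ℝ)) (b := L)).exists_bound_of_continuousOn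
    hφ.continuous_deriv.continuousOn
  have hswap := integral_integral_swap (μ := f.measure.restrict (Ioc 0 L))
    (ν := volume.restrict (Ioc 0 L)) (f := fun x y => (Ici x).indicator (deriv φ) y) (by
      have hm : Measurable (Function.uncurry fun x y => (Ici x).indicator (deriv φ) y) := by
        have : (Function.uncurry fun x y => (Ici x).indicator (deriv φ) y) =
            {p : ℝ × ℝ | p.1 ≤ p.2}.indicator fun p => deriv φ p.2 := by
          ext ⟨x, y⟩; simp [indicator]
        rw [this]
        exact (hφ.continuous_deriv.measurable.comp measurable_snd).indicator
          (measurableSet_le measurable_fst measurable_snd)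
      refine Integrable.of_bound hm.aestronglyMeasurable C ?_
      rw [Measure.prod_restrict]
      refine (ae_restrict_mem (measurableSet_Ioc.prod measurableSet_Ioc)).mono fun p hp => ?_
      refine (norm_indicator_le_norm_self _ _).trans (hC _ (Ioc_subset_Icc_self hp.2)))
  have h3 : ∀ y ∈ Ioc 0 L, ∫ x in Ioc 0 L, (Ici x).indicator (deriv φ) y ∂f.measure
      = (f y - f 0) * deriv φ y := by
    intro y hy
    have e : (fun x => (Ici x).indicator (deriv φ) y)
        = (Iic y).indicator fun _ => deriv φ y := by
      ext x; simp [indicator]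
    rw [e, setIntegral_indicator measurableSet_Iic, Ioc_inter_Iic, min_eq_right hy.2,
      setIntegral_const, Measure.real, f.measure_Ioc,
      ENNReal.toReal_ofReal (sub_nonneg.2 (f.mono hy.1.le)), smul_eq_mul]
  have h4 : IntegrableOn (fun y => f y * deriv φ y) (Ioc 0 L) :=
    ((f.mono.locallyIntegrable.integrableOn_isCompact isCompact_Icc).mul_continuousOn
      hφ.continuous_deriv.continuousOn isCompact_Icc).mono_set Ioc_subset_Icc_self
  rw [h1, setIntegral_congr_fun measurableSet_Ioc h2, integral_neg, neg_neg, hswap,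
    setIntegral_congr_fun measurableSet_Ioc h3, ← integral_Ioc_eq_integral_Ioo]
  simp only [sub_mul]
  rw [integral_sub h4 ((hφ.continuous_deriv.const_mul _).integrableOn_Icc.mono_set
    Ioc_subset_Icc_self), integral_const_mul, ← intervalIntegral.integral_of_le hL.le (f := deriv φ),
    hI, hφL, hφ0]
  ring

/-- At points where the primitive of u has derivative u, the averages over [s k, s k + δ] tend to u
(s k). Fields with ramps at these points therefore test u against jumps there as δ → 0, and Abel
summation produces the variation along s. -/
theorem sum_abs_sub_le_of_forall_isSobolevPair {L : ℝ} (hL : 0 < L) {u : ℝ → ℝ}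
    (hu : IntegrableOn u (Ioo 0 L)) {C : ℝ}
    (h : ∀ z z', IsSobolevPair 0 L z z' → z 0 = 0 → z L = 0 → (∀ y ∈ Icc 0 L, |z y| ≤ 1) →
      |∫ x in Ioo 0 L, u x * z' x| ≤ C)
    {s : ℕ → ℝ} (hs : Monotone s) (m : ℕ)
    (hmem : ∀ i, s i ∈ Ioo 0 L ∧ HasDerivAt (fun y => ∫ t in 0..y, u t) (u (s i)) (s i)) :
    ∑ i ∈ Finset.range m, |u (s (i + 1)) - u (s i)| ≤ C := by
  -- Minus the sign of the increment ending at s k. The zeros at k = 0 and k = m + 1 remove the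
  -- boundary terms and make the field vanish at both ends of the interval.
  let ζ : ℕ → ℝ := fun k => if k = 0 ∨ k = m + 1 then 0 else
    if 0 ≤ u (s k) - u (s (k - 1)) then -1 else 1
  have hζ : ∀ k, |ζ k| ≤ 1 := by
    intro k; simp only [ζ]; split_ifs <;> simp
  have hui : IntegrableOn u (Icc 0 L) := by rwa [integrableOn_Icc_iff_integrableOn_Ioo]
  have hII : ∀ {y}, y ∈ Icc 0 L → IntervalIntegrable u volume 0 y := fun hy => by
    rw [intervalIntegrable_iff_integrableOn_Icc_of_le hy.1]
    exact hui.mono_set (Icc_subset_Icc_right hy.2)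
  have hlim : Filter.Tendsto (fun δ : ℝ => ∑ k ∈ Finset.range (m + 1),
      (ζ (k + 1) - ζ k) * (δ⁻¹ * ∫ y in Ioc (s k) (s k + δ), u y)) (nhdsWithin 0 (Ioi 0))
      (nhds (∑ k ∈ Finset.range (m + 1), (ζ (k + 1) - ζ k) * u (s k))) := by
    refine tendsto_finsetSum _ fun k _ => Filter.Tendsto.const_mul _ ?_
    have h1 := (hasDerivAt_iff_tendsto_slope_zero.1 (hmem k).2).mono_left
      (nhdsWithin_mono 0 (show Ioi (0 : ℝ) ⊆ {0}ᶜ from fun x hx => ne_of_gt hx))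
    refine h1.congr' ?_
    have hk := (hmem k).1
    filter_upwards [Ioo_mem_nhdsGT (show (0 : ℝ) < L - s k by linarith [hk.2])] with δ hδ
    rw [intervalIntegral.integral_interval_sub_left
      (hII ⟨by linarith [hk.1, hδ.1], by linarith [hδ.2]⟩) (hII (Ioo_subset_Icc_self hk)),
      intervalIntegral.integral_of_le (by linarith [hδ.1]), smul_eq_mul]
  have hle : ∑ k ∈ Finset.range (m + 1), (ζ (k + 1) - ζ k) * u (s k) ≤ C := by
    refine le_of_tendsto hlim ?_
    filter_upwards [Ioo_mem_nhdsGT (show (0 : ℝ) < L - s m by linarith [(hmem m).1.2])] with δ hδ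
    obtain ⟨z, z', hz, hz0, hzL, hz1, hzu⟩ := exists_isSobolevPair_step hL (n := m + 1) (x := s)
      hδ.1 (fun k _ => hs k.le_succ) (fun k _ => (hmem k).1.1.le)
      (fun k hk => by linarith [hs (Nat.lt_succ_iff.1 hk), hδ.2]) (fun k _ => hζ k)
    rw [← hzu u hu]
    exact (le_abs_self _).trans (h z z' hz (hz0.trans (by simp [ζ])) (hzL.trans (by simp [ζ])) hz1)
  rw [sum_range_succ_sub_mul] at hle
  have e : ∑ k ∈ Finset.range m, ζ (k + 1) * (u (s (k + 1)) - u (s k))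
      = -∑ i ∈ Finset.range m, |u (s (i + 1)) - u (s i)| := by
    rw [← Finset.sum_neg_distrib]
    refine Finset.sum_congr rfl fun k hk => ?_
    have hk := Finset.mem_range.1 hk
    have : ¬(k + 1 = 0 ∨ k + 1 = m + 1) := by omega
    simp only [ζ, this, if_false, Nat.add_sub_cancel]
    split_ifs with h0
    · rw [abs_of_nonneg h0]; ring
    · rw [abs_of_neg (not_le.1 h0)]; ring
  rw [e] at hle
  simp only [ζ] at hle
  simpa using hle

/-- The two measures are the Stieltjes measures of the right-continuous versions of P and Q, which
differ from P and Q on countable sets only; restricting to (0, L] makes them finite. -/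
theorem memBVInterval_of_monotone_sub {L : ℝ} (hL : 0 < L) {u P Q : ℝ → ℝ}
    (hu : IntegrableOn u (Ioo 0 L)) (hP : Monotone P) (hQ : Monotone Q)
    (h : ∀ᵐ x, x ∈ Ioo 0 L → u x = P x - Q x) : MemBVInterval 0 L u := by
  refine ⟨hu, hP.stieltjesFunction.measure.restrict (Ioc 0 L),
    hQ.stieltjesFunction.measure.restrict (Ioc 0 L), ⟨by simp [StieltjesFunction.measure_Ioc]⟩,
    ⟨by simp [StieltjesFunction.measure_Ioc]⟩, fun φ hφ => ?_⟩
  have hae : ∀ {F : ℝ → ℝ} (hF : Monotone F), ∀ᵐ x, F x = hF.stieltjesFunction x := by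
    intro F hF
    have : {x | ¬ContinuousAt F x}.Countable := hF.countable_not_continuousAt
    filter_upwards [compl_mem_ae_iff.2 (this.measure_zero volume)] with x hx
    have hx : ContinuousAt F x := not_not.1 hx
    rw [hF.stieltjesFunction_eq]
    exact (hF.continuousWithinAt_Ioi_iff_rightLim_eq.1 hx.continuousWithinAt).symm
  have hi : ∀ f : StieltjesFunction ℝ, IntegrableOn (fun y => f y * deriv φ y) (Ioo 0 L) :=
    fun f => ((f.mono.locallyIntegrable.integrableOn_isCompact isCompact_Icc).mul_continuousOn
      hφ.continuous_deriv.continuousOn isCompact_Icc).mono_set Ioo_subset_Icc_self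
  rw [Measure.restrict_restrict measurableSet_Ioo, Measure.restrict_restrict measurableSet_Ioo,
    inter_eq_left.2 Ioo_subset_Ioc_self, neg_sub, ← neg_sub_neg,
    ← integral_stieltjes_mul_deriv hL _ hφ, ← integral_stieltjes_mul_deriv hL _ hφ,
    ← integral_sub (hi _) (hi _)]
  refine integral_congr_ae ((ae_restrict_iff' measurableSet_Ioo).2 ?_)
  filter_upwards [h, hae hP, hae hQ] with x hx h1 h2 hx'
  rw [hx hx', h1, h2, sub_mul]

/-- By Lebesgue differentiation the set S of points where the primitive has derivative u has full
measure. On S the pointwise variation is at most C, so u splits there into bounded monotone parts,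
and these extend to monotone functions on the line. -/
theorem memBVInterval_of_forall_isSobolevPair {L : ℝ} (hL : 0 < L) {u : ℝ → ℝ}
    (hu : IntegrableOn u (Ioo 0 L)) {C : ℝ}
    (h : ∀ z z', IsSobolevPair 0 L z z' → z 0 = 0 → z L = 0 → (∀ y ∈ Icc 0 L, |z y| ≤ 1) →
      |∫ x in Ioo 0 L, u x * z' x| ≤ C) : MemBVInterval 0 L u := by
  let S : Set ℝ := {x | x ∈ Ioo 0 L ∧ HasDerivAt (fun y => ∫ t in 0..y, u t) (u x) x}
  have hS : ∀ᵐ x, x ∈ Ioo 0 L → x ∈ S := by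
    have hI : IntervalIntegrable u volume 0 L := by
      rwa [intervalIntegrable_iff_integrableOn_Ioo_of_le hL.le]
    filter_upwards [hI.ae_hasDerivAt_integral] with x hx hx'
    refine ⟨hx', hx ?_ 0 (by simp)⟩
    rw [uIcc_of_le hL.le]; exact Ioo_subset_Icc_self hx'
  have hvar : eVariationOn u S ≤ ENNReal.ofReal C := by
    refine iSup_le fun p => ?_
    obtain ⟨m, s, hs, hmem⟩ := p
    have := sum_abs_sub_le_of_forall_isSobolevPair hL hu h hs m hmem
    simp only [edist_dist, Real.dist_eq]
    rw [← ENNReal.ofReal_sum_of_nonneg fun _ _ => abs_nonneg _]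
    exact ENNReal.ofReal_le_ofReal this
  have hbv : BoundedVariationOn u S := ne_top_of_le_ne_top ENNReal.ofReal_ne_top hvar
  have hne : S.Nonempty := by
    by_contra hne
    rw [not_nonempty_iff_eq_empty] at hne
    rw [hne] at hS
    have h0 : volume (Ioo 0 L) = 0 := by
      refine measure_mono_null (fun x hx => ?_) (ae_iff.1 hS)
      simpa using hx
    simp [hL.not_ge] at h0
  obtain ⟨x₀, hx₀⟩ := hne
  have hl := hbv.locallyBoundedVariationOn
  have hp := variationOnFromTo.monotoneOn hl hx₀
  have hq := variationOnFromTo.sub_self_monotoneOn hl hx₀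
  have hpb : ∀ x, |variationOnFromTo u S x₀ x| ≤ (eVariationOn u S).toReal := fun x =>
    variationOnFromTo.abs_le_eVariationOn hbv
  have hqb : ∀ x ∈ S, |(variationOnFromTo u S x₀ - u) x| ≤
      (eVariationOn u S).toReal + ((eVariationOn u S).toReal + |u x₀|) := by
    intro x hx
    have h1 := hbv.dist_le hx hx₀
    rw [Real.dist_eq] at h1
    have h2 := hpb x
    have h3 := abs_sub_abs_le_abs_sub (u x) (u x₀)
    have h4 := abs_sub (variationOnFromTo u S x₀ x) (u x)
    simp only [Pi.sub_apply]
    linarith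
  have hbdd : ∀ {f : ℝ → ℝ} {M : ℝ}, (∀ x ∈ S, |f x| ≤ M) →
      BddBelow (f '' S) ∧ BddAbove (f '' S) := fun {f M} hf =>
    ⟨⟨-M, by rintro _ ⟨x, hx, rfl⟩; exact (abs_le.1 (hf x hx)).1⟩,
      ⟨M, by rintro _ ⟨x, hx, rfl⟩; exact (abs_le.1 (hf x hx)).2⟩⟩
  obtain ⟨P, hP, hPe⟩ := hp.exists_monotone_extension (hbdd fun x _ => hpb x).1
    (hbdd fun x _ => hpb x).2
  obtain ⟨Q, hQ, hQe⟩ := hq.exists_monotone_extension (hbdd hqb).1 (hbdd hqb).2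
  refine memBVInterval_of_monotone_sub hL hu hP hQ ?_
  filter_upwards [hS] with x hx hx'
  rw [← hPe (hx hx'), ← hQe (hx hx')]
  simp

variable {V E : Type*} (G : MetricGraph V E) [Fintype E]

theorem ofReal_abs_sum_le_TV {u z z' : G.Fun} (hz : G.MemXK z z')
    (h1 : ∀ e, ∀ y ∈ Icc 0 (G.len e), |z e y| ≤ 1) :
    ENNReal.ofReal |∑ e, ∫ x in Ioo 0 (G.len e), u e x * z' e x| ≤ G.TV u := by
  refine le_iSup_of_le z <| le_iSup_of_le z' <| le_iSup_of_le hz <| le_iSup_of_le ?_ le_rfl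
  intro e
  rw [eLpNorm_exponent_top]
  refine eLpNormEssSup_le_of_ae_enorm_bound
    ((ae_restrict_mem measurableSet_Ioo).mono fun x hx => ?_)
  rw [Real.enorm_eq_ofReal_abs, ENNReal.ofReal_le_one]
  exact h1 e x (Ioo_subset_Icc_self hx)

theorem memBV_of_TV_ne_top {u : G.Fun} (hu : ∀ e, IntegrableOn (u e) (Ioo 0 (G.len e)))
    (h : G.TV u ≠ ⊤) : G.MemBV u := by
  classical
  intro e
  refine memBVInterval_of_forall_isSobolevPair (G.len_pos e) (hu e) (C := (G.TV u).toReal)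
    fun z z' hz h0 hL h1 => ?_
  -- A field vanishing at both ends of e extends by zero to the other edges without violating the
  -- Kirchhoff condition.
  let Z : G.Fun := fun e' => if e' = e then z else 0
  let Z' : G.Fun := fun e' => if e' = e then z' else 0
  have hZ : G.MemXK Z Z' := by
    constructor
    · intro e'
      by_cases he : e' = e
      · subst he; simpa [Z, Z'] using hz
      · simp only [Z, Z', he, if_false]
        exact ⟨continuousOn_const, MemLp.zero, MemLp.zero, by simp⟩
    · intro v
      refine Finset.sum_eq_zero fun e' _ => ?_
      unfold outward
      by_cases he : e' = e
      · subst he; simp [Z, h0, hL]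
      · simp [Z, he]
  have key := G.ofReal_abs_sum_le_TV (u := u) hZ fun e' y hy => by
    by_cases he : e' = e
    · subst he; simpa [Z] using h1 y hy
    · simp [Z, he]
  rw [Finset.sum_eq_single e (fun e' _ he => by simp [Z', he]) (by simp)] at key
  simp only [Z', if_true] at key
  exact (ENNReal.ofReal_le_iff_le_toReal h).1 key

end MetricGraph

/-! ### Finite combinatorics: balanced signs, weighted medians, integration over levels. -/

namespace MetricGraph

open Classical in
/-- Signs at a single node: half of the largest values get `1`, half of the smallest get `-1`. -/
theorem exists_balanced_sign {ι : Type*} (b : ι → ℝ) (S : Finset ι) :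
    ∃ o : ι → ℝ, (∀ i, |o i| ≤ 1) ∧ ∑ i ∈ S, o i = 0 ∧
      ∀ t, ∑ i ∈ S with t < b i, o i =
        min ((S.filter fun i => t < b i).card : ℝ) ((S.filter fun i => b i ≤ t).card : ℝ) := by
  induction hn : S.card using Nat.strong_induction_on generalizing S with
  | _ n ih =>
  rcases S.eq_empty_or_nonempty with rfl | hne
  · exact ⟨0, by simp, by simp, by simp⟩
  obtain ⟨i, hi, himax⟩ := S.exists_max_image b hne
  rcases (S.erase i).eq_empty_or_nonempty with he | hne'
  · have hS : S = {i} := by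
      rw [← Finset.insert_erase hi, he]; rfl
    refine ⟨0, by simp, by simp, fun t => ?_⟩
    rw [hS]
    by_cases h : t < b i
    · simp [Finset.filter_singleton, h, not_le.2 h]
    · simp [Finset.filter_singleton, h]
  obtain ⟨j, hj, hjmin⟩ := (S.erase i).exists_min_image b hne'
  have hji : j ≠ i := Finset.ne_of_mem_erase hj
  -- A largest value i gets 1, a smallest value j gets -1, and the rest R is treated by induction.
  -- For b j ≤ t < b i the pair adds one to the sum and one to each count; for any other t one of
  -- the two counts is zero.
  set R := (S.erase i).erase j with hR
  have hiR : i ∉ insert j R := by simp [hR, hji.symm]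
  have hjR : j ∉ R := by simp [hR]
  have hS : S = insert i (insert j R) := by
    rw [hR, Finset.insert_erase hj, Finset.insert_erase hi]
  have hbij : b j ≤ b i := himax j (Finset.mem_of_mem_erase hj)
  have hmaxR : ∀ k ∈ R, b k ≤ b i := fun k hk => himax k (by rw [hS]; simp [hk])
  have hminR : ∀ k ∈ R, b j ≤ b k := fun k hk => hjmin k (Finset.mem_of_mem_erase hk)
  obtain ⟨o, ho1, ho0, hot⟩ := ih R.card (by
    rw [← hn, hS, Finset.card_insert_of_notMem hiR, Finset.card_insert_of_notMem hjR]; omega) R rfl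
  let o' : ι → ℝ := fun k => if k = i then 1 else if k = j then -1 else o k
  have hiR' : i ∉ R := fun h => hiR (Finset.mem_insert_of_mem h)
  have hoR : ∀ T ⊆ R, ∑ k ∈ T, o' k = ∑ k ∈ T, o k := fun T hT =>
    Finset.sum_congr rfl fun k hk => by
      have h1 : k ≠ i := fun h => hiR' (h ▸ hT hk)
      have h2 : k ≠ j := fun h => hjR (h ▸ hT hk)
      simp [o', h1, h2]
  have hoi : o' i = 1 := by simp [o']
  have hoj : o' j = -1 := by simp [o', hji]
  refine ⟨o', fun k => ?_, ?_, fun t => ?_⟩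
  · simp only [o']; split_ifs <;> simp [ho1 k]
  · rw [hS, Finset.sum_insert hiR, Finset.sum_insert hjR, hoR R subset_rfl, ho0, hoi, hoj]; ring
  · by_cases h1 : t < b i
    · by_cases h2 : t < b j
      · have e1 : (S.filter fun k => t < b k) = S := Finset.filter_true_of_mem fun k hk => by
          rw [hS, Finset.mem_insert, Finset.mem_insert] at hk
          rcases hk with rfl | rfl | hk
          exacts [h1, h2, h2.trans_le (hminR k hk)]
        have e2 : (S.filter fun k => b k ≤ t) = ∅ := by
          rw [← Finset.filter_true_of_mem (s := S) (p := fun k => t < b k)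
            (Finset.filter_eq_self.1 e1), Finset.filter_filter]
          exact Finset.filter_false_of_mem fun k _ h => not_le.2 h.1 h.2
        rw [e1, e2, hS, Finset.sum_insert hiR, Finset.sum_insert hjR, hoR R subset_rfl, ho0, hoi,
          hoj]
        simp only [Finset.card_empty, Nat.cast_zero]
        rw [min_eq_right (Nat.cast_nonneg _)]; ring
      · have h3 : i ∉ R.filter fun k => t < b k := fun h => hiR' (Finset.mem_of_mem_filter _ h)
        have h4 : j ∉ R.filter fun k => b k ≤ t := fun h => hjR (Finset.mem_of_mem_filter _ h)
        rw [hS, Finset.filter_insert, Finset.filter_insert, Finset.filter_insert,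
          Finset.filter_insert, if_pos h1, if_neg h2, if_neg (not_le.2 h1), if_pos (not_lt.1 h2),
          Finset.sum_insert h3, hoi, hoR _ (Finset.filter_subset _ _), hot,
          Finset.card_insert_of_notMem h3, Finset.card_insert_of_notMem h4]
        push_cast
        rw [min_add_add_right]; ring
    · have e1 : (S.filter fun k => t < b k) = ∅ := Finset.filter_false_of_mem fun k hk =>
        not_lt.2 ((himax k hk).trans (not_lt.1 h1))
      rw [e1]; simp

-- At each node, a balanced choice bounded by 1 has a sum over {t < b} of at most the number of
-- entries there, and, the total being zero, also at most the number of entries in {b ≤ t}.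
-- `exists_balanced_sign` attains the minimum of the two for every t at once, so the choice does not
-- depend on t.
open Classical in
theorem exists_optimal_on_superlevels {H N : Type*} [Fintype H] (node : H → N) (b : H → ℝ) :
    ∃ o : H → ℝ, (∀ h, |o h| ≤ 1) ∧ (∀ x, ∑ h with node h = x, o h = 0) ∧
      ∀ (t : ℝ) (o' : H → ℝ), (∀ h, |o' h| ≤ 1) → (∀ x, ∑ h with node h = x, o' h = 0) →
        ∑ h with t < b h, o' h ≤ ∑ h with t < b h, o h := by
  choose o ho1 ho0 hot using fun x => exists_balanced_sign b (Finset.univ.filter fun h => node h = x)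
  have hc : ∀ x, ∀ T ⊆ (Finset.univ.filter fun h => node h = x),
      ∑ h ∈ T, o (node h) h = ∑ h ∈ T, o x h := fun x T hT =>
    Finset.sum_congr rfl fun h hh => by rw [(Finset.mem_filter.1 (hT hh)).2]
  refine ⟨fun h => o (node h) h, fun h => ho1 _ _, fun x => ?_, fun t o' h1 h0 => ?_⟩
  · rw [hc x _ subset_rfl, ho0]
  · have hmaps : ∀ h ∈ Finset.univ.filter (fun h => t < b h),
        node h ∈ Finset.univ.image node := fun h _ => Finset.mem_image_of_mem _ (Finset.mem_univ _)
    rw [← Finset.sum_fiberwise_of_maps_to hmaps, ← Finset.sum_fiberwise_of_maps_to hmaps]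
    refine Finset.sum_le_sum fun x _ => ?_
    rw [Finset.filter_filter]
    simp only [and_comm (a := t < b _)]
    rw [← Finset.filter_filter, hc x _ (Finset.filter_subset _ _), hot]
    have hle : ∀ T : Finset H, |∑ h ∈ T, o' h| ≤ T.card := fun T =>
      (Finset.abs_sum_le_sum_abs _ _).trans
        ((Finset.sum_le_sum fun h _ => h1 h).trans (by simp))
    refine le_min ((le_abs_self _).trans (hle _)) ?_
    have := Finset.sum_filter_add_sum_filter_not (Finset.univ.filter fun h => node h = x)
      (fun h => t < b h) o'
    rw [h0 x] at this
    simp only [not_lt] at this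
    have h2 := (neg_le_abs _).trans
      (hle ((Finset.univ.filter fun h => node h = x).filter fun h => b h ≤ t))
    linarith

theorem exists_weighted_median {I : Type*} [Fintype I] (w a : I → ℝ) (hw : ∀ i, 0 ≤ w i)
    (hpos : 0 < ∑ i, w i) :
    ∃ c, (∀ t, c < t → ∑ i with t < a i, w i ≤ ∑ i with a i ≤ t, w i) ∧
      ∀ t, t < c → ∑ i with a i ≤ t, w i ≤ ∑ i with t < a i, w i := by
  -- T is an upward closed half-line, and its infimum is the median. Nothing is claimed at t = c,
  -- which is a null set of levels.
  let T : Set ℝ := {t | ∑ i with t < a i, w i ≤ ∑ i with a i ≤ t, w i}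
  have hT : ∀ t, t ∈ T ↔ ∑ i with t < a i, w i ≤ ∑ i with a i ≤ t, w i := fun _ => Iff.rfl
  obtain ⟨M, hM⟩ : ∃ M, ∀ i, |a i| ≤ M :=
    ⟨∑ i, |a i|, fun i => Finset.single_le_sum (fun j _ => abs_nonneg (a j)) (Finset.mem_univ i)⟩
  have hne : T.Nonempty := by
    refine ⟨M, (hT M).2 ?_⟩
    rw [Finset.filter_false_of_mem (p := fun i => M < a i)
      fun i _ => not_lt.2 ((le_abs_self _).trans (hM i))]
    simpa using Finset.sum_nonneg fun i _ => hw i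
  have hbdd : BddBelow T := by
    refine ⟨-M, fun t ht => not_lt.1 fun htM => ?_⟩
    have hlt : ∀ i, t < a i := fun i => htM.trans_le (abs_le.1 (hM i)).1
    rw [hT, Finset.filter_true_of_mem fun i _ => hlt i,
      Finset.filter_false_of_mem (p := fun i => a i ≤ t) fun i _ => not_le.2 (hlt i),
      Finset.sum_empty] at ht
    linarith
  refine ⟨sInf T, fun t ht => ?_, fun t ht => ?_⟩
  · obtain ⟨s, hs, hst⟩ := exists_lt_of_csInf_lt hne ht
    rw [hT] at hs
    refine le_trans ?_ (hs.trans ?_)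
    · exact Finset.sum_le_sum_of_subset_of_nonneg
        (Finset.monotone_filter_right _ fun i _ h => hst.trans h) fun i _ _ => hw i
    · exact Finset.sum_le_sum_of_subset_of_nonneg
        (Finset.monotone_filter_right _ fun i _ h => h.trans hst.le) fun i _ _ => hw i
  · have : t ∉ T := fun h => (csInf_le hbdd h).not_gt ht
    exact (not_le.1 this).le

theorem integral_indicator_Ico (a b : ℝ) :
    ∫ t, (Ico a b).indicator (fun _ => (1 : ℝ)) t = max (b - a) 0 := by
  rw [integral_indicator measurableSet_Ico]
  simp [Measure.real, ENNReal.toReal_ofReal']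

theorem integrable_indicator_Ico (a b : ℝ) :
    Integrable ((Ico a b).indicator fun _ => (1 : ℝ)) :=
  (integrable_indicator_iff measurableSet_Ico).2 (by simp)

/-- If every superlevel set satisfies an isoperimetric inequality, then so does the function. -/
theorem exists_mul_sum_abs_sub_le {H I : Type*} [Fintype H] [Fintype I] (cell : H → I)
    (w a : I → ℝ) (o : H → ℝ) (hw : ∀ i, 0 ≤ w i) (hpos : 0 < ∑ i, w i) (ho : ∑ h, o h = 0)
    {κ : ℝ} (hκ : ∀ t, κ * min (∑ i with t < a i, w i) (∑ i with a i ≤ t, w i) ≤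
      ∑ h with t < a (cell h), o h) :
    ∃ c, κ * ∑ i, w i * |a i - c| ≤ ∑ h, o h * a (cell h) := by
  obtain ⟨c, hc1, hc2⟩ := exists_weighted_median w a hw hpos
  refine ⟨c, ?_⟩
  let χ : ℝ → ℝ → ℝ → ℝ := fun x y => (Ico x y).indicator fun _ => (1 : ℝ)
  have hχ : ∀ x y, Integrable (χ x y) := integrable_indicator_Ico
  have i1 : ∀ h, Integrable fun t => o h * (χ c (a (cell h)) t - χ (a (cell h)) c t) :=
    fun h => ((hχ _ _).sub (hχ _ _)).const_mul _
  have i2 : ∀ i, Integrable fun t => w i * (χ c (a i) t + χ (a i) c t) :=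
    fun i => ((hχ _ _).add (hχ _ _)).const_mul _
  -- The signed layer-cake formula: the integrand in t has integral a - c, and the constant c drops
  -- out because the o h sum to zero.
  have e1 : ∫ t, ∑ h, o h * (χ c (a (cell h)) t - χ (a (cell h)) c t) =
      ∑ h, o h * a (cell h) := by
    rw [integral_finsetSum _ fun h _ => i1 h]
    have : ∀ h, ∫ t, o h * (χ c (a (cell h)) t - χ (a (cell h)) c t) =
        o h * a (cell h) - o h * c := by
      intro h
      rw [integral_const_mul, integral_sub (hχ _ _) (hχ _ _), integral_indicator_Ico,
        integral_indicator_Ico, ← mul_sub]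
      congr 1
      rcases le_total (a (cell h)) c with h | h
      · rw [max_eq_right (by linarith), max_eq_left (by linarith)]; ring
      · rw [max_eq_left (by linarith), max_eq_right (by linarith)]; ring
    simp only [this]
    rw [Finset.sum_sub_distrib, ← Finset.sum_mul, ho]; ring
  have e2 : ∫ t, κ * ∑ i, w i * (χ c (a i) t + χ (a i) c t) = κ * ∑ i, w i * |a i - c| := by
    rw [integral_const_mul, integral_finsetSum _ fun i _ => i2 i]
    congr 1
    refine Finset.sum_congr rfl fun i _ => ?_
    rw [integral_const_mul, integral_add (hχ _ _) (hχ _ _), integral_indicator_Ico,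
        integral_indicator_Ico]
    congr 1
    rcases le_total (a i) c with h | h
    · rw [max_eq_right (by linarith), max_eq_left (by linarith), abs_of_nonpos (by linarith)]; ring
    · rw [max_eq_left (by linarith), max_eq_right (by linarith), abs_of_nonneg (by linarith)]; ring
  rw [← e1, ← e2]
  refine integral_mono_ae
    ((integrable_finsetSum _ fun i _ => i2 i).const_mul _)
    (integrable_finsetSum _ fun h _ => i1 h) ?_
  have hne : ∀ᵐ t : ℝ, t ≠ c := by simp [ae_iff, measure_singleton]
  filter_upwards [hne] with t ht
  -- For t > c the sum runs over the ends above t. For t < c it is minus the sum over the ends not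
  -- above t, which is the same number since the total is zero.
  have f1 : ∑ h, o h * (χ c (a (cell h)) t - χ (a (cell h)) c t) =
      ∑ h with t < a (cell h), o h := by
    rw [Finset.sum_filter]
    rcases lt_or_gt_of_ne ht with h | h
    · have : ∀ h, o h * (χ c (a (cell h)) t - χ (a (cell h)) c t) =
          (if t < a (cell h) then o h else 0) - o h := by
        intro i
        by_cases hi : t < a (cell i) <;> simp [χ, hi, h, not_le.2 h, not_le.2, not_lt.1]
      simp only [this, Finset.sum_sub_distrib, ho, sub_zero]
    · refine Finset.sum_congr rfl fun i _ => ?_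
      by_cases hi : t < a (cell i) <;> simp [χ, hi, h.le, h.not_gt]
  refine le_trans (le_of_eq ?_) ((hκ t).trans f1.ge)
  congr 1
  -- The median decides which of the two weights is the minimum: the lower one for t < c, the upper
  -- one for t > c.
  rcases lt_or_gt_of_ne ht with h | h
  · rw [min_eq_right (hc2 t h), Finset.sum_filter]
    refine Finset.sum_congr rfl fun i _ => ?_
    by_cases hi : a i ≤ t <;> simp [χ, hi, h, not_le.2 h]
  · rw [min_eq_left (hc1 t h), Finset.sum_filter]
    refine Finset.sum_congr rfl fun i _ => ?_
    by_cases hi : t < a i <;> simp [χ, hi, h.le, h.not_gt]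

end MetricGraph

/-! ### Sets, lengths and total variation on the graph. -/

namespace MetricGraph

variable {V E : Type*} (G : MetricGraph V E)

theorem point_of_mem_Ioo {e : E} {x : ℝ} (h : x ∈ Ioo 0 (G.len e)) :
    G.point e x = Sum.inr ⟨e, ⟨x, h⟩⟩ := dif_pos h

theorem exists_point_eq_inl {e : E} {x : ℝ} (h : x ∉ Ioo 0 (G.len e)) :
    ∃ v, G.point e x = Sum.inl v := by
  by_cases h0 : x ≤ 0
  · exact ⟨G.init e, (dif_neg h).trans (if_pos h0)⟩
  · exact ⟨G.term e, (dif_neg h).trans (if_neg h0)⟩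

theorem exists_point_eq_iff {e : E} {x : ℝ} (q : E → ℝ → Prop) :
    (∃ e', ∃ y ∈ Ioo 0 (G.len e'), G.point e x = G.point e' y ∧ q e' y) ↔
      x ∈ Ioo 0 (G.len e) ∧ q e x := by
  constructor
  · rintro ⟨e', y, hy, hp, hq⟩
    rw [G.point_of_mem_Ioo hy] at hp
    by_cases h : x ∈ Ioo 0 (G.len e)
    · rw [G.point_of_mem_Ioo h] at hp
      obtain ⟨rfl, hp⟩ := Sigma.mk.inj_iff.1 (Sum.inr_injective hp)
      have hxy : x = y := congrArg Subtype.val (eq_of_heq hp)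
      subst hxy
      exact ⟨h, hq⟩
    · obtain ⟨v, hv⟩ := G.exists_point_eq_inl h
      exact (Sum.inl_ne_inr (hv.symm.trans hp)).elim
  · rintro ⟨h, hq⟩
    exact ⟨e, x, h, rfl, hq⟩

theorem coordSet_superlevel (u : G.Fun) (t : ℝ) (e : E) :
    G.coordSet (G.superlevel u t) e = {x | x ∈ Ioo 0 (G.len e) ∧ t < u e x} := by
  ext x
  constructor
  · rintro ⟨hx, h⟩
    exact (G.exists_point_eq_iff fun e x => t < u e x).1 h
  · intro h
    have hx := Ioo_subset_Icc_self h.1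
    exact ⟨hx, (G.exists_point_eq_iff fun e x => t < u e x).2 h⟩

theorem coordSet_sublevel (u : G.Fun) (t : ℝ) (e : E) :
    G.coordSet (G.sublevel u t) e = {x | x ∈ Ioo 0 (G.len e) ∧ u e x < t} := by
  ext x
  constructor
  · rintro ⟨hx, h⟩
    exact (G.exists_point_eq_iff fun e x => u e x < t).1 h
  · intro h
    have hx := Ioo_subset_Icc_self h.1
    exact ⟨hx, (G.exists_point_eq_iff fun e x => u e x < t).2 h⟩

theorem coordSet_subset (A : Set G.Point) (e : E) : G.coordSet A e ⊆ Icc 0 (G.len e) :=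
  fun _ h => h.1

theorem coordSet_compl (A : Set G.Point) (e : E) :
    G.coordSet Aᶜ e = Icc 0 (G.len e) \ G.coordSet A e := by
  ext x
  simp only [coordSet, mem_ofPred_eq, mem_compl_iff, Set.mem_sdiff]
  tauto

theorem IsMeasurable.compl {A : Set G.Point} (hA : G.IsMeasurable A) : G.IsMeasurable Aᶜ := by
  intro e
  rw [coordSet_compl]
  exact measurableSet_Icc.nullMeasurableSet.diff (hA e)

theorem char_compl (A : Set G.Point) {e : E} {x : ℝ} (hx : x ∈ Icc 0 (G.len e)) :
    G.char Aᶜ e x = 1 - G.char A e x := by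
  unfold char
  rw [coordSet_compl]
  by_cases h : x ∈ G.coordSet A e <;> simp [indicator, h, hx]

theorem integrableOn_char {A : Set G.Point} (hA : G.IsMeasurable A) (e : E) (s : Set ℝ)
    (hs : volume s ≠ ⊤) : IntegrableOn (G.char A e) s := by
  have : IntegrableOn (fun _ : ℝ => (1 : ℝ)) s := integrableOn_const hs
  exact this.indicator₀ ((hA e).mono_ac Measure.restrict_le_self.absolutelyContinuous)

variable [Fintype E]

theorem length_add_length_compl {A : Set G.Point} (hA : G.IsMeasurable A) :
    G.length A + G.length Aᶜ = ENNReal.ofReal G.totalLength := by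
  rw [← length_univ]
  unfold length
  rw [← Finset.sum_add_distrib]
  refine Finset.sum_congr rfl fun e _ => ?_
  have h : G.coordSet univ e = Icc 0 (G.len e) := by
    ext x; simp [coordSet]
  rw [h, coordSet_compl, ← measure_inter_add_sdiff₀ (Icc 0 (G.len e)) (hA e),
    inter_eq_right.2 (G.coordSet_subset A e)]

theorem length_ne_top (A : Set G.Point) : G.length A ≠ ⊤ :=
  ENNReal.sum_ne_top.2 fun e _ =>
    measure_ne_top_of_subset (G.coordSet_subset A e) (by simp)

theorem totalLength_pos [Nonempty E] : 0 < G.totalLength :=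
  Finset.sum_pos (fun e _ => G.len_pos e) Finset.univ_nonempty

open Classical in
theorem sum_outward_eq (z : G.Fun) (v : V) :
    ∑ e ∈ G.incidentEdges v, G.outward z e v =
      ∑ e, ((if G.term e = v then z e (G.len e) else 0) - if G.init e = v then z e 0 else 0) := by
  unfold incidentEdges
  rw [Finset.sum_filter]
  refine Finset.sum_congr rfl fun e _ => ?_
  unfold outward
  have := G.no_loops e
  by_cases h1 : G.init e = v
  · have h2 : G.term e ≠ v := fun h => this (h1.trans h.symm)
    simp [h1, h2, h2.symm]
  · by_cases h2 : G.term e = v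
    · simp [h1, h2]
    · simp [h1, h2]

/-- Summing the Kirchhoff conditions over all vertices counts each edge end once. Hence TV ignores
additive constants, which gives complements equal perimeter. -/
theorem sum_integral_deriv_eq_zero {z z' : G.Fun} (hz : G.MemXK z z') [Fintype V] :
    ∑ e, ∫ x in Ioo 0 (G.len e), z' e x = 0 := by
  classical
  have h1 : ∀ e, ∫ x in Ioo 0 (G.len e), z' e x = z e (G.len e) - z e 0 := fun e => by
    rw [(hz.1 e).sub_eq_integral (G.len_pos e) le_rfl (G.len_pos e).le le_rfl,
      integral_Ioc_eq_integral_Ioo]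
  have h2 := Finset.sum_eq_zero fun v (_ : v ∈ Finset.univ) => hz.2 v
  simp only [sum_outward_eq] at h2
  rw [Finset.sum_comm] at h2
  refine Eq.trans ?_ h2
  refine Finset.sum_congr rfl fun e _ => ?_
  rw [h1, Finset.sum_sub_distrib]
  simp

theorem TV_le_of_forall {u : G.Fun} {C : ℝ≥0∞}
    (h : ∀ z z', G.MemXK z z' → (∀ e, ∀ y ∈ Icc 0 (G.len e), |z e y| ≤ 1) →
      ENNReal.ofReal |∑ e, ∫ x in Ioo 0 (G.len e), u e x * z' e x| ≤ C) : G.TV u ≤ C :=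
  iSup_le fun z => iSup_le fun z' => iSup_le fun hz => iSup_le fun h1 => h z z' hz fun e _ hy =>
    abs_le_one_of_eLpNorm_le (G.len_pos e) (hz.1 e).1 (h1 e) hy

theorem TV_congr {u v : G.Fun} {c : ℝ}
    (h : ∀ z z', G.MemXK z z' → ∑ e, ∫ x in Ioo 0 (G.len e), u e x * z' e x =
      c * ∑ e, ∫ x in Ioo 0 (G.len e), v e x * z' e x) :
    G.TV u = ENNReal.ofReal |c| * G.TV v := by
  unfold TV
  simp only [ENNReal.mul_iSup]
  refine iSup_congr fun z => iSup_congr fun z' => iSup_congr fun hz => iSup_congr fun _ => ?_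
  rw [h z z' hz, abs_mul, ENNReal.ofReal_mul (abs_nonneg c)]

end MetricGraph

/-! ### Division of the edges into cells, and discrete fields. -/

namespace MetricGraph

variable {V E : Type*} (G : MetricGraph V E)

/-- The length of a cell when the edge `e` is divided into `n` equal cells. -/
def mesh (n : ℕ) (e : E) : ℝ := G.len e / n

/-- The `k`-th cell of the edge `e`. -/
def cell (n : ℕ) (e : E) (k : ℕ) : Set ℝ := Ioc (k * G.mesh n e) (k * G.mesh n e + G.mesh n e)

/-- The mean of `u` over a cell. -/
def cellMean (n : ℕ) (u : G.Fun) (e : E) (k : ℕ) : ℝ :=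
  (G.mesh n e)⁻¹ * ∫ x in G.cell n e k, u e x

/-- The function with the value `a e k` on the `k`-th cell of `e`. -/
def stepFun (n : ℕ) (a : E → ℕ → ℝ) : G.Fun := fun e x => a e (⌈x / G.mesh n e⌉₊ - 1)

/-- The `k`-th division point of the edge `e`. -/
def gridNode (n : ℕ) (e : E) (k : ℕ) : V ⊕ E × ℕ :=
  if k = 0 then Sum.inl (G.init e) else if k = n then Sum.inl (G.term e) else Sum.inr (e, k)

/-- The division point at an end of a cell. -/
def endNode (n : ℕ) (h : E × Fin n × Bool) : V ⊕ E × ℕ :=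
  G.gridNode n h.1 (if h.2.2 then (h.2.1 : ℕ) + 1 else h.2.1)

/-- The outward value at an end of a cell of a field with the value `ζ e k` at the `k`-th division
point of `e`. -/
def endValue (n : ℕ) (ζ : E → ℕ → ℝ) (h : E × Fin n × Bool) : ℝ :=
  if h.2.2 then ζ h.1 (h.2.1 + 1) else -ζ h.1 h.2.1

variable {G}

theorem mesh_pos {n : ℕ} (hn : 0 < n) (e : E) : 0 < G.mesh n e :=
  div_pos (G.len_pos e) (Nat.cast_pos.2 hn)

theorem mul_mesh {n : ℕ} (hn : 0 < n) (e : E) : n * G.mesh n e = G.len e :=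
  mul_div_cancel₀ _ (Nat.cast_pos.2 hn).ne'

theorem cell_subset {n : ℕ} (hn : 0 < n) (e : E) {k : ℕ} (hk : k < n) :
    G.cell n e k ⊆ Ioc 0 (G.len e) := by
  have h := mesh_pos (G := G) hn e
  refine Ioc_subset_Ioc (by positivity) ?_
  rw [← mul_mesh hn e, ← add_one_mul]
  gcongr
  exact_mod_cast hk

theorem stepFun_eq {n : ℕ} (hn : 0 < n) (a : E → ℕ → ℝ) {e : E} {k : ℕ} {x : ℝ}
    (hx : x ∈ G.cell n e k) : G.stepFun n a e x = a e k := by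
  have h := mesh_pos (G := G) hn e
  -- Cells are open on the left and closed on the right, so the ceiling on the k-th cell is k + 1;
  -- this explains the shift in `stepFun`.
  have : ⌈x / G.mesh n e⌉₊ = k + 1 := by
    rw [Nat.ceil_eq_iff (Nat.succ_ne_zero k), lt_div_iff₀ h, div_le_iff₀ h, Nat.succ_sub_one]
    push_cast
    exact ⟨hx.1, hx.2.trans_eq (by ring)⟩
  unfold stepFun
  rw [this, Nat.add_sub_cancel]

theorem integral_eq_sum_cell {n : ℕ} (hn : 0 < n) (e : E) {f : ℝ → ℝ}
    (hf : IntegrableOn f (Ioo 0 (G.len e))) :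
    ∫ x in Ioo 0 (G.len e), f x = ∑ k ∈ Finset.range n, ∫ x in G.cell n e k, f x := by
  have h := mesh_pos (G := G) hn e
  have e1 : ∀ k : ℕ, (k : ℝ) * G.mesh n e + G.mesh n e = ((k + 1 : ℕ) : ℝ) * G.mesh n e := by
    intro k; push_cast; ring
  have := intervalIntegral.sum_integral_adjacent_intervals (f := f) (μ := volume)
    (a := fun k : ℕ => (k : ℝ) * G.mesh n e) (n := n) fun k hk => by
      rw [intervalIntegrable_iff_integrableOn_Ioc_of_le (by rw [← e1]; linarith), ← e1]
      rw [← integrableOn_Ioc_iff_integrableOn_Ioo] at hf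
      exact hf.mono_set (cell_subset hn e hk)
  rw [Nat.cast_zero, zero_mul, mul_mesh hn, intervalIntegral.integral_of_le (G.len_pos e).le,
    integral_Ioc_eq_integral_Ioo] at this
  rw [← this]
  refine Finset.sum_congr rfl fun k _ => ?_
  rw [intervalIntegral.integral_of_le (by rw [← e1]; linarith), ← e1, cell]

theorem gridNode_zero (n : ℕ) (e : E) : G.gridNode n e 0 = Sum.inl (G.init e) := if_pos rfl

theorem gridNode_last {n : ℕ} (hn : 0 < n) (e : E) : G.gridNode n e n = Sum.inl (G.term e) := by
  simp [gridNode, hn.ne']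

theorem gridNode_eq_inr_iff {n : ℕ} {e e' : E} {k k' : ℕ} :
    G.gridNode n e k = Sum.inr (e', k') ↔ k ≠ 0 ∧ k ≠ n ∧ e = e' ∧ k = k' := by
  unfold gridNode
  split_ifs with h1 h2 <;> simp_all

theorem abs_le_one_of_abs_endValue_le_one {n : ℕ} (hn : 0 < n) {ζ : E → ℕ → ℝ}
    (h : ∀ h, |endValue n ζ h| ≤ 1) (e : E) {k : ℕ} (hk : k ≤ n) : |ζ e k| ≤ 1 := by
  rcases hk.lt_or_eq with hk | rfl
  · simpa [endValue] using h (e, ⟨k, hk⟩, false)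
  · have := h (e, ⟨k - 1, by omega⟩, true)
    rwa [endValue, if_pos rfl, Nat.sub_add_cancel hn] at this

theorem measurable_stepFun (n : ℕ) (a : E → ℕ → ℝ) (e : E) : Measurable (G.stepFun n a e) :=
  (measurable_from_nat (f := fun k => a e (k - 1))).comp
    (Nat.measurable_ceil.comp (measurable_id.div_const _))

theorem isMeasurable_superlevel_stepFun (n : ℕ) (a : E → ℕ → ℝ) (t : ℝ) :
    G.IsMeasurable (G.superlevel (G.stepFun n a) t) := by
  intro e
  rw [coordSet_superlevel]
  exact (measurableSet_Ioo.inter (measurableSet_lt measurable_const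
    (measurable_stepFun n a e))).nullMeasurableSet

open Classical in
theorem char_superlevel_stepFun {n : ℕ} (hn : 0 < n) (a : E → ℕ → ℝ) (t : ℝ) {e : E} {k : ℕ}
    {x : ℝ} (hx : x ∈ G.cell n e k) (hx' : x ∈ Ioo 0 (G.len e)) :
    G.char (G.superlevel (G.stepFun n a) t) e x = if t < a e k then 1 else 0 := by
  have : x ∈ G.coordSet (G.superlevel (G.stepFun n a) t) e ↔ t < a e k := by
    rw [coordSet_superlevel]
    exact (and_iff_right hx').trans (by rw [stepFun_eq hn a hx])
  by_cases h : t < a e k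
  · rw [if_pos h]
    exact indicator_of_mem (this.2 h) _
  · rw [if_neg h]
    exact indicator_of_notMem (fun h' => h (this.1 h')) _

variable [Fintype E]

theorem sum_ends_mul {n : ℕ} (ζ a : E → ℕ → ℝ) :
    ∑ h, endValue n ζ h * a h.1 h.2.1 =
      ∑ e, ∑ k ∈ Finset.range n, (ζ e (k + 1) - ζ e k) * a e k := by
  rw [Fintype.sum_prod_type]
  refine Finset.sum_congr rfl fun e _ => ?_
  rw [Fintype.sum_prod_type, ← Fin.sum_univ_eq_sum_range
    (fun k => (ζ e (k + 1) - ζ e k) * a e k) n]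
  refine Finset.sum_congr rfl fun k _ => ?_
  simp [endValue]
  ring

/-- The sum telescopes along each edge, as the two cell ends meeting at an interior division point
carry opposite values. With ψ the indicator of a node it computes the balance at that node. -/
theorem sum_endValue_mul {n : ℕ} (hn : 0 < n) (ζ : E → ℕ → ℝ) (ψ : V ⊕ E × ℕ → ℝ) :
    ∑ h, endValue n ζ h * ψ (G.endNode n h) =
      ∑ e, (ζ e n * ψ (Sum.inl (G.term e)) - ζ e 0 * ψ (Sum.inl (G.init e))) := by
  rw [Fintype.sum_prod_type]
  refine Finset.sum_congr rfl fun e _ => ?_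
  rw [Fintype.sum_prod_type, ← gridNode_last hn, ← gridNode_zero n,
    ← Finset.sum_range_sub (fun k => ζ e k * ψ (G.gridNode n e k)), ← Fin.sum_univ_eq_sum_range
    (fun k => ζ e (k + 1) * ψ (G.gridNode n e (k + 1)) - ζ e k * ψ (G.gridNode n e k)) n]
  refine Finset.sum_congr rfl fun k _ => ?_
  simp [endValue, endNode]
  ring

open Classical in
theorem sum_endValue_fiber {n : ℕ} (hn : 0 < n) (ζ : E → ℕ → ℝ) (v : V) :
    ∑ h with G.endNode n h = Sum.inl v, endValue n ζ h =
      ∑ e, ((if G.term e = v then ζ e n else 0) - if G.init e = v then ζ e 0 else 0) := by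
  have := sum_endValue_mul hn ζ (G := G) fun x => if x = Sum.inl v then 1 else 0
  simp only [mul_ite, mul_one, mul_zero, Sum.inl.injEq] at this
  rw [Finset.sum_filter, this]

open Classical in
theorem sum_endValue_fiber_inr {n : ℕ} (hn : 0 < n) (ζ : E → ℕ → ℝ) (p : E × ℕ) :
    ∑ h with G.endNode n h = Sum.inr p, endValue n ζ h = 0 := by
  have := sum_endValue_mul hn ζ (G := G) fun x => if x = Sum.inr p then 1 else 0
  simp only [mul_ite, mul_one, mul_zero, reduceCtorEq, if_false, sub_zero,
    Finset.sum_const_zero] at this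
  rw [Finset.sum_filter, this]

-- Exactly two cell ends meet at an interior division point, so balance there makes their outward
-- values opposite, that is, given by a single field value ζ.
open Classical in
theorem exists_eq_endValue {n : ℕ} (hn : 0 < n) {o : E × Fin n × Bool → ℝ}
    (ho : ∀ x, ∑ h with G.endNode n h = x, o h = 0) :
    ∃ ζ : E → ℕ → ℝ, o = endValue n ζ := by
  let ζ : E → ℕ → ℝ := fun e k => if hk : k < n then -o (e, ⟨k, hk⟩, false) else
    o (e, ⟨n - 1, by omega⟩, true)
  refine ⟨ζ, ?_⟩
  ext ⟨e, ⟨k, hk⟩, b⟩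
  rcases b with _ | _
  · simp [endValue, ζ, hk]
  · by_cases hk' : k + 1 < n
    · have h1 := ho (Sum.inr (e, k + 1))
      have h2 : (Finset.univ.filter fun h => G.endNode n h = Sum.inr (e, k + 1)) =
          {(e, ⟨k, hk⟩, true), (e, ⟨k + 1, hk'⟩, false)} := by
        ext ⟨e', ⟨k', hk''⟩, b'⟩
        rcases b' with _ | _
        · simp [endNode, gridNode_eq_inr_iff]
          grind
        · simp [endNode, gridNode_eq_inr_iff]
          grind
      rw [h2, Finset.sum_pair (by simp)] at h1
      simp only [endValue, ζ, hk', if_true, dif_pos]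
      linarith
    · have : k = n - 1 := by omega
      subst this
      simp [endValue, ζ, hk']

open Classical in
/-- A balanced choice of outward values at the ends of all cells bounds the total variation from
below. -/
theorem ofReal_sum_mul_cellMean_le_TV {n : ℕ} (hn : 0 < n) {u : G.Fun}
    (hu : ∀ e, IntegrableOn (u e) (Ioo 0 (G.len e))) {o : E × Fin n × Bool → ℝ}
    (ho1 : ∀ h, |o h| ≤ 1) (ho : ∀ x, ∑ h with G.endNode n h = x, o h = 0) :
    ENNReal.ofReal (∑ h, o h * G.cellMean n u h.1 h.2.1) ≤ G.TV u := by
  obtain ⟨ζ, rfl⟩ := exists_eq_endValue hn ho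
  -- The ramps have the width of a cell and start at its left end, so the field is the linear
  -- interpolation of ζ. Its derivative is constant on cells, and pairing with u sees only the cell
  -- means.
  have hm := fun e => mesh_pos (G := G) hn e
  have hstep := fun e => exists_isSobolevPair_step (G.len_pos e) (n := n)
    (x := fun k => k * G.mesh n e) (ζ := ζ e) (hm e)
    (fun k _ => mul_le_mul_of_nonneg_right (Nat.cast_le.2 k.le_succ) (hm e).le)
    (fun k _ => mul_nonneg k.cast_nonneg (hm e).le)
    (fun k hk => by
      rw [← mul_mesh hn e, ← add_one_mul]
      exact mul_le_mul_of_nonneg_right (by exact_mod_cast hk) (hm e).le)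
    (fun k hk => abs_le_one_of_abs_endValue_le_one hn ho1 e hk)
  choose z z' hz hz0 hzL hz1 hzu using hstep
  have hX : G.MemXK z z' := by
    refine ⟨hz, fun v => ?_⟩
    refine (G.sum_outward_eq z v).trans (Eq.trans ?_ (ho (Sum.inl v)))
    rw [sum_endValue_fiber hn]
    exact Finset.sum_congr rfl fun e _ => by rw [hz0, hzL]
  refine le_trans (ENNReal.ofReal_le_ofReal ?_) (G.ofReal_abs_sum_le_TV (u := u) hX hz1)
  refine le_trans (le_of_eq ?_) (le_abs_self _)
  rw [sum_ends_mul]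
  exact Finset.sum_congr rfl fun e _ => (hzu e (u e) (hu e)).symm

open Classical in
theorem sum_integral_char_superlevel_stepFun {n : ℕ} (hn : 0 < n) (a : E → ℕ → ℝ) (t : ℝ)
    {f : E → ℝ → ℝ} (hf : ∀ e, IntegrableOn (f e) (Ioo 0 (G.len e))) :
    ∑ e, ∫ x in Ioo 0 (G.len e), G.char (G.superlevel (G.stepFun n a) t) e x * f e x =
      ∑ e, ∑ k ∈ Finset.range n, if t < a e k then ∫ x in G.cell n e k, f e x else 0 := by
  refine Finset.sum_congr rfl fun e _ => ?_
  have hD := isMeasurable_superlevel_stepFun (G := G) n a t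
  have hi : IntegrableOn (fun x => G.char (G.superlevel (G.stepFun n a) t) e x * f e x)
      (Ioo 0 (G.len e)) := by
    refine Integrable.bdd_mul (c := 1) (hf e)
      (G.integrableOn_char hD e _ (by simp)).aestronglyMeasurable (.of_forall fun x => ?_)
    unfold char
    exact (norm_indicator_le_norm_self _ _).trans (by simp)
  rw [integral_eq_sum_cell hn e hi]
  refine Finset.sum_congr rfl fun k hk => ?_
  -- The last cell contains the end point of the edge, which `superlevel` leaves out.
  have hne : ∀ᵐ x : ℝ, x ≠ G.len e := by simp [ae_iff, measure_singleton]
  have : ∀ᵐ x, x ∈ G.cell n e k → G.char (G.superlevel (G.stepFun n a) t) e x * f e x =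
      (if t < a e k then 1 else 0) * f e x := by
    filter_upwards [hne] with x hx hxc
    have := cell_subset hn e (Finset.mem_range.1 hk) hxc
    rw [char_superlevel_stepFun hn a t hxc ⟨this.1, this.2.lt_of_ne hx⟩]
  rw [setIntegral_congr_ae (show MeasurableSet (G.cell n e k) from measurableSet_Ioc) this,
    integral_const_mul, ite_mul, one_mul, zero_mul]

-- The characteristic function is constant on cells up to null sets, so its pairing with z' depends
-- only on the values of z at the division points; these form a balanced choice of outward values to
-- which the hypothesis applies.
open Classical in
theorem Per_superlevel_stepFun_le {n : ℕ} (hn : 0 < n) (a : E → ℕ → ℝ) (t : ℝ) {M : ℝ}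
    (hM : ∀ o : E × Fin n × Bool → ℝ, (∀ h, |o h| ≤ 1) →
      (∀ x, ∑ h with G.endNode n h = x, o h = 0) → ∑ h with t < a h.1 h.2.1, o h ≤ M) :
    G.Per (G.superlevel (G.stepFun n a) t) ≤ ENNReal.ofReal M := by
  refine G.TV_le_of_forall fun z z' hz hz1 => ENNReal.ofReal_le_ofReal ?_
  let ζ : E → ℕ → ℝ := fun e k => z e (k * G.mesh n e)
  have hm := fun e => mesh_pos (G := G) hn e
  have hgrid : ∀ e, ∀ k ≤ n, (k : ℝ) * G.mesh n e ∈ Icc 0 (G.len e) := fun e k hk => by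
    refine ⟨mul_nonneg k.cast_nonneg (hm e).le, ?_⟩
    rw [← mul_mesh hn e]
    exact mul_le_mul_of_nonneg_right (Nat.cast_le.2 hk) (hm e).le
  have h1 : ∀ h, |endValue n ζ h| ≤ 1 := by
    rintro ⟨e, k, b⟩
    unfold endValue
    split_ifs
    · exact hz1 e _ (hgrid e _ k.2)
    · rw [abs_neg]; exact hz1 e _ (hgrid e _ k.2.le)
  have h0 : ∀ x, ∑ h with G.endNode n h = x, endValue n ζ h = 0 := by
    rintro (v | p)
    · refine (sum_endValue_fiber hn ζ v).trans (Eq.trans ?_ (hz.2 v))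
      rw [sum_outward_eq]
      simp [ζ, mul_mesh hn]
    · exact sum_endValue_fiber_inr hn ζ p
  have hsum : ∑ e, ∫ x in Ioo 0 (G.len e), G.char (G.superlevel (G.stepFun n a) t) e x * z' e x =
      ∑ h with t < a h.1 h.2.1, endValue n ζ h := by
    rw [sum_integral_char_superlevel_stepFun hn a t
      fun e => integrableOn_of_memLp_two (hz.1 e).2.2.1, Finset.sum_filter]
    have := sum_ends_mul (n := n) ζ fun e k => if t < a e k then (1 : ℝ) else 0
    simp only [mul_ite, mul_one, mul_zero] at this
    rw [this]
    refine Finset.sum_congr rfl fun e _ => Finset.sum_congr rfl fun k hk => ?_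
    have hk := Finset.mem_range.1 hk
    congr 1
    have e1 : (k : ℝ) * G.mesh n e + G.mesh n e = ((k + 1 : ℕ) : ℝ) * G.mesh n e := by
      push_cast; ring
    rw [cell, ← (hz.1 e).sub_eq_integral (G.len_pos e) (hgrid e k hk.le).1
      (by linarith [hm e]) (e1 ▸ (hgrid e (k + 1) hk).2), e1]
  rw [hsum]
  -- The negative of an admissible choice is admissible, which takes care of the absolute value.
  refine abs_le'.2 ⟨hM _ h1 h0, ?_⟩
  rw [← Finset.sum_neg_distrib]
  exact hM (fun h => -endValue n ζ h) (fun h => by rw [abs_neg]; exact h1 h)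
    fun x => by rw [Finset.sum_neg_distrib, h0, neg_zero]

open Classical in
theorem length_superlevel_stepFun {n : ℕ} (hn : 0 < n) (a : E → ℕ → ℝ) (t : ℝ) :
    G.length (G.superlevel (G.stepFun n a) t) =
      ENNReal.ofReal (∑ i : E × Fin n with t < a i.1 i.2, G.mesh n i.1) := by
  have hD := isMeasurable_superlevel_stepFun (G := G) n a t
  have h1 := sum_integral_char_superlevel_stepFun (G := G) hn a t (f := fun _ _ => 1)
    fun e => integrableOn_const (by simp)
  have h2 : ∀ e, volume (G.coordSet (G.superlevel (G.stepFun n a) t) e) = ENNReal.ofReal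
      (∫ x in Ioo 0 (G.len e), G.char (G.superlevel (G.stepFun n a) t) e x * 1) := by
    intro e
    have hs : G.coordSet (G.superlevel (G.stepFun n a) t) e ⊆ Ioo 0 (G.len e) := by
      rw [coordSet_superlevel]; exact fun x hx => hx.1
    simp only [mul_one]
    unfold char
    rw [integral_indicator₀ ((hD e).mono_ac Measure.restrict_le_self.absolutelyContinuous),
      Measure.restrict_restrict₀ ((hD e).mono_ac Measure.restrict_le_self.absolutelyContinuous),
      inter_eq_left.2 hs, setIntegral_const, smul_eq_mul, mul_one, Measure.real,
      ENNReal.ofReal_toReal (measure_ne_top_of_subset hs (by simp))]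
  unfold length
  rw [Finset.sum_congr rfl fun e _ => h2 e, ← ENNReal.ofReal_sum_of_nonneg, h1]
  · congr 1
    rw [Finset.sum_filter, Fintype.sum_prod_type]
    refine Finset.sum_congr rfl fun e _ => ?_
    rw [Fin.sum_univ_eq_sum_range (fun k => if t < a e k then G.mesh n e else 0) n]
    refine Finset.sum_congr rfl fun k _ => ?_
    congr 1
    simp [cell, Measure.real, (mesh_pos (G := G) hn e).le]
  · intro e _
    refine integral_nonneg fun x => ?_
    rw [Pi.zero_apply, mul_one]
    exact indicator_nonneg (fun _ _ => zero_le_one) x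

theorem sum_mesh {n : ℕ} (hn : 0 < n) : ∑ i : E × Fin n, G.mesh n i.1 = G.totalLength := by
  rw [Fintype.sum_prod_type]
  refine Finset.sum_congr rfl fun e _ => ?_
  simp [mul_mesh hn]

open Classical in
theorem length_superlevel_stepFun_compl {n : ℕ} (hn : 0 < n) (a : E → ℕ → ℝ) (t : ℝ) :
    G.length (G.superlevel (G.stepFun n a) t)ᶜ =
      ENNReal.ofReal (∑ i : E × Fin n with a i.1 i.2 ≤ t, G.mesh n i.1) := by
  have hpos : ∀ s : Finset (E × Fin n), 0 ≤ ∑ i ∈ s, G.mesh n i.1 := fun s =>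
    Finset.sum_nonneg fun i _ => (mesh_pos hn i.1).le
  have h := G.length_add_length_compl (isMeasurable_superlevel_stepFun (G := G) n a t)
  have h2 := Finset.sum_filter_add_sum_filter_not Finset.univ
    (fun i : E × Fin n => t < a i.1 i.2) fun i => G.mesh n i.1
  simp only [not_lt] at h2
  rw [length_superlevel_stepFun hn, ← sum_mesh hn, ← h2, ENNReal.ofReal_add (hpos _) (hpos _)] at h
  exact (ENNReal.add_right_inj ENNReal.ofReal_ne_top).1 h

end MetricGraph

/-! ### The Poincaré inequality and its limit: h ≤ λ₁. -/

namespace MetricGraph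

variable {V E : Type*} {G : MetricGraph V E}

theorem tendsto_sum_integral_abs_sub_cellMean {u : G.Fun} {e : E}
    (hu : IntegrableOn (u e) (Ioo 0 (G.len e))) {ε : ℝ} (hε : 0 < ε) :
    ∀ᶠ n : ℕ in Filter.atTop, ∑ k ∈ Finset.range n,
      ∫ x in G.cell n e k, |u e x - G.cellMean n u e k| ≤ ε := by
  have hL := G.len_pos e
  -- The distance from v to g is counted twice, once directly and once through the cell means,
  -- giving 2 · ε/4; the oscillation of g on the cells gives the other ε/2.
  obtain ⟨g, hgc, hgε, hg, hgi⟩ := ((integrable_indicator_iff measurableSet_Ioo).2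
    hu).exists_hasCompactSupport_integral_sub_le (show 0 < ε / 4 by positivity)
  set v := (Ioo 0 (G.len e)).indicator (u e) with hv
  have hvi : Integrable v := (integrable_indicator_iff measurableSet_Ioo).2 hu
  simp only [Real.norm_eq_abs] at hgε
  have hdi : Integrable fun x => |v x - g x| := (hvi.sub hgi).abs
  have hη' : 0 < ε / (2 * G.len e) := by positivity
  obtain ⟨η, hη, hgη⟩ := Metric.uniformContinuous_iff.1
    (hgc.uniformContinuous_of_continuous hg) _ hη'
  have hlim : Filter.Tendsto (fun n : ℕ => G.len e / n) Filter.atTop (nhds 0) :=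
    tendsto_const_div_atTop_nhds_zero_nat _
  filter_upwards [Filter.eventually_gt_atTop 0, hlim.eventually (gt_mem_nhds hη)] with n hn hnη
  have hm := mesh_pos (G := G) hn e
  have hcell : ∀ k, volume.real (G.cell n e k) = G.mesh n e := fun k => by
    simp [cell, Measure.real, hm.le]
  have hcm : ∀ k, MeasurableSet (G.cell n e k) := fun k => measurableSet_Ioc
  have hcf : ∀ k, volume (G.cell n e k) ≠ ⊤ := fun k => by simp [cell]
  have hci : ∀ k (c : ℝ), IntegrableOn (fun _ => c) (G.cell n e k) := fun k c =>
    integrableOn_const (hcf k) (by simp)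
  have hae : ∀ k < n, ∀ᵐ x, x ∈ G.cell n e k → u e x = v x := fun k hk => by
    have hne : ∀ᵐ x : ℝ, x ≠ G.len e := by simp [ae_iff, measure_singleton]
    filter_upwards [hne] with x hx hxc
    have := cell_subset hn e hk hxc
    exact (indicator_of_mem (show x ∈ Ioo 0 (G.len e) from ⟨this.1, this.2.lt_of_ne hx⟩) _).symm
  have hbound : ∀ k < n, ∫ x in G.cell n e k, |u e x - G.cellMean n u e k| ≤
      2 * (∫ x in G.cell n e k, |v x - g x|) + ε / (2 * G.len e) * G.mesh n e := by
    intro k hk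
    set m := G.cellMean n u e k with hmdef
    have hm1 : ∫ y in G.cell n e k, v y = G.mesh n e * m := by
      rw [hmdef, cellMean, setIntegral_congr_ae (hcm k) (hae k hk), mul_inv_cancel_left₀ hm.ne']
    have hpt : ∀ x ∈ G.cell n e k, |v x - m| ≤ |v x - g x| + (ε / (2 * G.len e) +
        (G.mesh n e)⁻¹ * ∫ y in G.cell n e k, |v y - g y|) := by
      intro x hx
      have h1 : |g x - m| ≤ ε / (2 * G.len e) +
          (G.mesh n e)⁻¹ * ∫ y in G.cell n e k, |v y - g y| := by
        have h2 : G.mesh n e * (g x - m) = ∫ y in G.cell n e k, (g x - v y) := by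
          rw [integral_sub (hci k _) hvi.integrableOn, hm1, setIntegral_const,
            hcell, smul_eq_mul]
          ring
        have h3 : |∫ y in G.cell n e k, (g x - v y)| ≤
            ∫ y in G.cell n e k, (ε / (2 * G.len e) + |v y - g y|) := by
          refine abs_integral_le_integral_abs.trans (setIntegral_mono_on
            ((hci k _).sub hvi.integrableOn).abs
            ((hci k _).add hdi.integrableOn) (hcm k) fun y hy => ?_)
          have h4 : |g x - g y| < ε / (2 * G.len e) := by
            refine hgη (lt_of_le_of_lt ?_ hnη)
            rw [Real.dist_eq, abs_le]
            change _ ≤ x - y ∧ x - y ≤ G.mesh n e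
            change - G.mesh n e ≤ x - y ∧ _
            constructor <;> linarith [hx.1, hx.2, hy.1, hy.2]
          have h5 := abs_sub_le (g x) (g y) (v y)
          rw [abs_sub_comm (g y)] at h5
          linarith
        rw [← h2, integral_add (hci k _) hdi.integrableOn, setIntegral_const,
          hcell, smul_eq_mul, abs_mul, abs_of_pos hm] at h3
        rw [← mul_le_mul_iff_right₀ hm, mul_add, mul_inv_cancel_left₀ hm.ne']
        exact h3
      linarith [abs_sub_le (v x) (g x) m]
    have h6 : ∫ x in G.cell n e k, |u e x - m| = ∫ x in G.cell n e k, |v x - m| :=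
      setIntegral_congr_ae (hcm k) ((hae k hk).mono fun x hx hx' => by rw [hx hx'])
    rw [h6]
    refine (setIntegral_mono_on (hvi.integrableOn.sub (hci k _)).abs
      (hdi.integrableOn.add (hci k _)) (hcm k) hpt).trans (le_of_eq ?_)
    refine (integral_add hdi.integrableOn (hci k _)).trans ?_
    rw [setIntegral_const, hcell,
      smul_eq_mul, mul_add, mul_inv_cancel_left₀ hm.ne']
    ring
  refine (Finset.sum_le_sum fun k hk => hbound k (Finset.mem_range.1 hk)).trans ?_
  rw [Finset.sum_add_distrib, ← Finset.mul_sum, ← integral_eq_sum_cell hn e hdi.integrableOn,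
    Finset.sum_const, Finset.card_range, nsmul_eq_mul, mul_left_comm, mul_mesh hn]
  have h7 : ∫ x in Ioo 0 (G.len e), |v x - g x| ≤ ε / 4 :=
    (setIntegral_le_integral hdi (.of_forall fun x => abs_nonneg _)).trans hgε
  have h8 : ε / (2 * G.len e) * G.len e = ε / 2 := by field_simp
  rw [h8]
  linarith

variable [Fintype E]

theorem cheeger_mul_min_le {D : Set G.Point} (hD : G.IsMeasurable D) :
    G.cheeger * min (G.length D) (G.length Dᶜ) ≤ G.Per D := by
  rcases eq_or_ne (G.length D) 0 with h0 | h0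
  · simp [h0]
  rcases eq_or_ne (G.length Dᶜ) 0 with h1 | h1
  · simp [h1]
  have hlt : G.length D < ENNReal.ofReal G.totalLength := by
    rw [← G.length_add_length_compl hD]
    exact ENNReal.lt_add_right (G.length_ne_top D) h1
  have : G.cheeger ≤ G.Per D / min (G.length D) (G.length Dᶜ) :=
    iInf_le_of_le D <| iInf_le_of_le hD <| iInf_le_of_le (pos_iff_ne_zero.2 h0) <|
      iInf_le_of_le hlt le_rfl
  exact (ENNReal.le_div_iff_mul_le (.inl (by simp [h0, h1]))
    (.inl (ne_top_of_le_ne_top (G.length_ne_top D) (min_le_left _ _)))).1 this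

theorem cheeger_ne_top [Nonempty E] : G.cheeger ≠ ⊤ := by
  classical
  obtain ⟨e₀⟩ := ‹Nonempty E›
  -- The competitor is the first half of one edge; its perimeter is at most the number of cell ends.
  let a : E → ℕ → ℝ := fun e k => if e = e₀ ∧ k = 0 then 1 else 0
  have hn : 0 < 2 := two_pos
  have hPer := Per_superlevel_stepFun_le (G := G) hn a 0
    (M := Fintype.card (E × Fin 2 × Bool)) fun o ho _ => by
      refine (Finset.sum_le_sum fun h _ => (le_abs_self _).trans (ho h)).trans ?_
      rw [Finset.sum_const, nsmul_eq_mul, mul_one]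
      exact_mod_cast Finset.card_le_univ _
  have hpos : ∀ (s : Finset (E × Fin 2)) (i : E × Fin 2), i ∈ s →
      0 < ENNReal.ofReal (∑ i ∈ s, G.mesh 2 i.1) := fun s i hi =>
    ENNReal.ofReal_pos.2 (Finset.sum_pos (fun i _ => mesh_pos hn i.1) ⟨i, hi⟩)
  have h1 : 0 < G.length (G.superlevel (G.stepFun 2 a) 0) := by
    rw [length_superlevel_stepFun hn]
    exact hpos _ (e₀, 0) (by simp [a])
  have h2 : 0 < G.length (G.superlevel (G.stepFun 2 a) 0)ᶜ := by
    rw [length_superlevel_stepFun_compl hn]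
    exact hpos _ (e₀, 1) (by simp [a])
  intro h
  have := cheeger_mul_min_le (isMeasurable_superlevel_stepFun (G := G) 2 a 0)
  rw [h, ENNReal.top_mul (lt_min h1 h2).ne'] at this
  exact ENNReal.ofReal_ne_top (top_le_iff.1 (this.trans hPer))

/-- Poincaré inequality for cell means. -/
theorem exists_ofReal_mul_sum_abs_le_TV [Nonempty E] {n : ℕ} (hn : 0 < n) {u : G.Fun}
    (hu : ∀ e, IntegrableOn (u e) (Ioo 0 (G.len e))) :
    ∃ c, ENNReal.ofReal (G.cheeger.toReal * ∑ e, ∑ k ∈ Finset.range n,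
      G.mesh n e * |G.cellMean n u e k - c|) ≤ G.TV u := by
  classical
  obtain ⟨o, ho1, ho0, homax⟩ := exists_optimal_on_superlevels (G.endNode n)
    fun h : E × Fin n × Bool => G.cellMean n u h.1 h.2.1
  have hsum : ∑ h, o h = 0 := by
    rw [← Finset.sum_fiberwise_of_maps_to (t := Finset.univ.image (G.endNode n))
      fun h _ => Finset.mem_image_of_mem _ (Finset.mem_univ h)]
    refine Finset.sum_eq_zero fun x _ => ?_
    convert ho0 x
  have hpos : ∀ s : Finset (E × Fin n), 0 ≤ ∑ i ∈ s, G.mesh n i.1 := fun s =>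
    Finset.sum_nonneg fun i _ => (mesh_pos hn i.1).le
  obtain ⟨c, hc⟩ := exists_mul_sum_abs_sub_le (fun h : E × Fin n × Bool => (h.1, h.2.1))
    (fun i => G.mesh n i.1) (fun i => G.cellMean n u i.1 i.2) o
    (fun i => (mesh_pos hn i.1).le) (by rw [sum_mesh hn]; exact G.totalLength_pos) hsum
    (κ := G.cheeger.toReal) fun t => by
      have h1 := cheeger_mul_min_le
        (isMeasurable_superlevel_stepFun (G := G) n (G.cellMean n u) t)
      -- Optimality of o at level t is used here: no other balanced choice has a larger sum over the
      -- ends above t.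
      have h2 := h1.trans (Per_superlevel_stepFun_le hn (G.cellMean n u) t
        (M := ∑ h with t < G.cellMean n u h.1 h.2.1, o h) fun o' h1' h0' => by
          convert homax t o' h1' fun x => by convert h0' x)
      rw [length_superlevel_stepFun hn, length_superlevel_stepFun_compl hn,
        ← ENNReal.ofReal_toReal (cheeger_ne_top (G := G)), ← ENNReal.ofReal_min,
        ← ENNReal.ofReal_mul ENNReal.toReal_nonneg] at h2
      have h3 : 0 ≤ ∑ h with t < G.cellMean n u h.1 h.2.1, o h := by
        have := homax t 0 (by simp) (by simp)
        simp only [Pi.zero_apply, Finset.sum_const_zero] at this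
        convert this
      convert (ENNReal.ofReal_le_ofReal_iff h3).1 h2
  refine ⟨c, le_trans (ENNReal.ofReal_le_ofReal ?_) (ofReal_sum_mul_cellMean_le_TV hn hu ho1
    fun x => by convert ho0 x)⟩
  refine le_trans (le_of_eq ?_) hc
  congr 1
  rw [Fintype.sum_prod_type]
  exact Finset.sum_congr rfl fun e _ => (Fin.sum_univ_eq_sum_range
    (fun k => G.mesh n e * |G.cellMean n u e k - c|) n).symm

/-- Pointwise |u| ≤ |u - c| - c + 2c χ_{u > 0}, and the last two terms have non-positive integral
because {u > 0} fills at most half of the graph. -/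
theorem sum_integral_abs_le_of_length_superlevel_le {u : G.Fun}
    (hu : ∀ e, IntegrableOn (u e) (Ioo 0 (G.len e)))
    (h : G.length (G.superlevel u 0) ≤ ENNReal.ofReal (G.totalLength / 2)) {c : ℝ} (hc : 0 ≤ c) :
    ∑ e, ∫ x in Ioo 0 (G.len e), |u e x| ≤ ∑ e, ∫ x in Ioo 0 (G.len e), |u e x - c| := by
  let S : E → Set ℝ := fun e => G.coordSet (G.superlevel u 0) e
  have hSs : ∀ e, S e ⊆ Ioo 0 (G.len e) := fun e => by
    simp only [S, coordSet_superlevel]; exact fun x hx => hx.1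
  have hSm : ∀ e, NullMeasurableSet (S e) (volume.restrict (Ioo 0 (G.len e))) := fun e => by
    simp only [S, coordSet_superlevel]
    exact measurableSet_Ioo.nullMeasurableSet.inter
      (nullMeasurableSet_lt aemeasurable_const (hu e).aemeasurable)
  have hle : ∑ e, volume.real (S e) ≤ G.totalLength / 2 := by
    have hpos : 0 ≤ G.totalLength / 2 := by
      have : 0 ≤ G.totalLength := Finset.sum_nonneg fun e _ => (G.len_pos e).le
      linarith
    have := ENNReal.toReal_mono ENNReal.ofReal_ne_top h
    rwa [ENNReal.toReal_ofReal hpos, length, ENNReal.toReal_sum fun e _ =>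
      measure_ne_top_of_subset (hSs e) (by simp)] at this
  have hedge : ∀ e, ∫ x in Ioo 0 (G.len e), |u e x| ≤
      (∫ x in Ioo 0 (G.len e), |u e x - c|) - (c * G.len e - 2 * c * volume.real (S e)) := by
    intro e
    have i1 : IntegrableOn (fun _ : ℝ => c) (Ioo 0 (G.len e)) := integrableOn_const (by simp) (by simp)
    have i2 : IntegrableOn ((S e).indicator fun _ => 2 * c) (Ioo 0 (G.len e)) :=
      (integrable_const (2 * c)).indicator₀ (hSm e)
    have i3 : ∫ x in Ioo 0 (G.len e), (S e).indicator (fun _ => 2 * c) x =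
        2 * c * volume.real (S e) := by
      rw [integral_indicator₀ (hSm e), Measure.restrict_restrict₀ (hSm e),
        inter_eq_left.2 (hSs e), setIntegral_const, smul_eq_mul, mul_comm]
    have i4 : ∫ x in Ioo 0 (G.len e), c = c * G.len e := by
      simp [Measure.real, (G.len_pos e).le, mul_comm]
    have i5 : IntegrableOn (fun x => |u e x - c|) (Ioo 0 (G.len e)) := ((hu e).sub i1).abs
    have i6 : IntegrableOn (fun x => c - (S e).indicator (fun _ => 2 * c) x) (Ioo 0 (G.len e)) :=
      i1.sub i2
    rw [← i3, ← i4, ← integral_sub i1 i2, ← integral_sub i5 i6]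
    refine setIntegral_mono_on (hu e).abs (i5.sub i6) measurableSet_Ioo fun x hx => ?_
    by_cases h0 : 0 < u e x
    · have : x ∈ S e := by simp only [S, coordSet_superlevel]; exact ⟨hx, h0⟩
      rw [indicator_of_mem this, abs_of_pos h0]
      linarith [le_abs_self (u e x - c)]
    · have : x ∉ S e := by simp only [S, coordSet_superlevel]; exact fun h => h0 h.2
      rw [indicator_of_notMem this, abs_of_nonpos (not_lt.1 h0)]
      linarith [neg_le_abs (u e x - c)]
  refine (Finset.sum_le_sum fun e _ => hedge e).trans ?_
  rw [Finset.sum_sub_distrib, Finset.sum_sub_distrib, ← Finset.mul_sum, ← Finset.mul_sum]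
  change _ - (c * G.totalLength - _) ≤ _
  nlinarith

theorem IsMedian.sum_integral_abs_le {u : G.Fun}
    (hu : ∀ e, IntegrableOn (u e) (Ioo 0 (G.len e))) (h : G.IsMedian u 0) (c : ℝ) :
    ∑ e, ∫ x in Ioo 0 (G.len e), |u e x| ≤ ∑ e, ∫ x in Ioo 0 (G.len e), |u e x - c| := by
  rcases le_total 0 c with hc | hc
  · exact sum_integral_abs_le_of_length_superlevel_le hu h.2 hc
  · let v : G.Fun := fun e x => -u e x
    have hv : G.superlevel v 0 = G.sublevel u 0 := by
      simp only [superlevel, sublevel, v, neg_pos]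
    have := sum_integral_abs_le_of_length_superlevel_le (u := v) (fun e => (hu e).neg)
      (by rw [hv]; exact h.1) (neg_nonneg.2 hc)
    have e1 : ∀ e x, |v e x| = |u e x| := fun e x => abs_neg _
    have e2 : ∀ e x, |v e x - -c| = |u e x - c| := fun e x => by
      rw [← abs_neg (u e x - c)]; congr 1; simp only [v]; ring
    simpa only [e1, e2] using this

theorem sum_integral_abs_eq_one {u : G.Fun} (hu : ∀ e, IntegrableOn (u e) (Ioo 0 (G.len e)))
    (h : G.normL1 u = 1) : ∑ e, ∫ x in Ioo 0 (G.len e), |u e x| = 1 := by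
  have : ∀ e, eLpNorm (u e) 1 (volume.restrict (Ioo 0 (G.len e))) =
      ENNReal.ofReal (∫ x in Ioo 0 (G.len e), |u e x|) := fun e => by
    rw [eLpNorm_one_eq_lintegral_enorm, ← ofReal_integral_norm_eq_lintegral_enorm (hu e)]
    rfl
  unfold normL1 at h
  rw [Finset.sum_congr rfl fun e _ => this e] at h
  exact ENNReal.ofReal_eq_one.1 ((ENNReal.ofReal_sum_of_nonneg fun e _ =>
    integral_nonneg fun x => abs_nonneg _).trans h)

theorem cheeger_le_TV [Nonempty E] {u : G.Fun} (hu : u ∈ G.admissible) : G.cheeger ≤ G.TV u := by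
  obtain ⟨hbv, hnorm, hmed⟩ := hu
  have hi : ∀ e, IntegrableOn (u e) (Ioo 0 (G.len e)) := fun e => (hbv e).1
  rcases eq_or_ne (G.TV u) ⊤ with htop | htop
  · rw [htop]; exact le_top
  have hκ : 0 ≤ G.cheeger.toReal := ENNReal.toReal_nonneg
  -- The median property gives 1 = ∫|u| ≤ ∫|u - c|, and replacing u by its cell means costs at most
  -- ε in L¹.
  have key : ∀ ε > 0, G.cheeger.toReal * (1 - ε) ≤ (G.TV u).toReal := by
    intro ε hε
    have hcard : (0 : ℝ) < Fintype.card E := Nat.cast_pos.2 Fintype.card_pos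
    have hev : ∀ᶠ n : ℕ in Filter.atTop, ∀ e, ∑ k ∈ Finset.range n,
        ∫ x in G.cell n e k, |u e x - G.cellMean n u e k| ≤ ε / Fintype.card E :=
      Filter.eventually_all.2 fun e =>
        tendsto_sum_integral_abs_sub_cellMean (hi e) (by positivity)
    obtain ⟨n, hn, hne⟩ := ((Filter.eventually_gt_atTop 0).and hev).exists
    obtain ⟨c, hc⟩ := exists_ofReal_mul_sum_abs_le_TV hn hi
    refine le_trans (mul_le_mul_of_nonneg_left ?_ hκ) ((ENNReal.ofReal_le_iff_le_toReal htop).1 hc)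
    have h1 := IsMedian.sum_integral_abs_le hi hmed c
    rw [sum_integral_abs_eq_one hi hnorm] at h1
    have h2 : ∀ e, ∫ x in Ioo 0 (G.len e), |u e x - c| ≤ ε / Fintype.card E +
        ∑ k ∈ Finset.range n, G.mesh n e * |G.cellMean n u e k - c| := by
      intro e
      have hc1 : IntegrableOn (fun _ : ℝ => c) (Ioo 0 (G.len e)) := integrableOn_const (by simp) (by simp)
      have hi1 : IntegrableOn (fun x => |u e x - c|) (Ioo 0 (G.len e)) := ((hi e).sub hc1).abs
      rw [integral_eq_sum_cell hn e hi1]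
      refine le_trans ?_ (add_le_add_left (hne e) _)
      rw [← Finset.sum_add_distrib]
      refine Finset.sum_le_sum fun k hk => ?_
      have hcf : volume (G.cell n e k) ≠ ⊤ := by simp [cell]
      have hci : ∀ c : ℝ, IntegrableOn (fun _ => c) (G.cell n e k) := fun c =>
        integrableOn_const hcf (by simp)
      have hcm : volume.real (G.cell n e k) = G.mesh n e := by
        simp [cell, Measure.real, (mesh_pos (G := G) hn e).le]
      have hic : IntegrableOn (u e) (G.cell n e k) := by
        have := hi e
        rw [← integrableOn_Ioc_iff_integrableOn_Ioo] at this
        exact this.mono_set (cell_subset hn e (Finset.mem_range.1 hk))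
      rw [← hcm, ← smul_eq_mul, ← setIntegral_const]
      refine le_of_le_of_eq ?_ (integral_add (hic.sub (hci _)).abs (hci _))
      exact integral_mono (hic.sub (hci _)).abs
        ((hic.sub (hci _)).abs.add (hci _))
        fun x => abs_sub_le _ _ _
    have h3 := h1.trans (Finset.sum_le_sum fun e _ => h2 e)
    rw [Finset.sum_add_distrib, Finset.sum_const, Finset.card_univ, nsmul_eq_mul,
      mul_div_cancel₀ _ hcard.ne'] at h3
    linarith
  have hlim : G.cheeger.toReal ≤ (G.TV u).toReal := by
    have ht : Filter.Tendsto (fun ε : ℝ => G.cheeger.toReal * (1 - ε)) (nhdsWithin 0 (Ioi 0))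
        (nhds G.cheeger.toReal) := by
      have : Filter.Tendsto (fun ε : ℝ => G.cheeger.toReal * (1 - ε)) (nhds 0)
          (nhds (G.cheeger.toReal * (1 - 0))) := by
        exact Continuous.tendsto (by fun_prop) 0
      rw [sub_zero, mul_one] at this
      exact this.mono_left nhdsWithin_le_nhds
    exact le_of_tendsto ht (Filter.eventually_of_mem self_mem_nhdsWithin fun ε hε => key ε hε)
  exact (ENNReal.toReal_le_toReal cheeger_ne_top htop).1 hlim

end MetricGraph

/-! ### Characteristic functions as competitors: λ₁ ≤ h, and the cut function. -/

namespace MetricGraph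

variable {V E : Type*} {G : MetricGraph V E}

theorem integrableOn_char_mul {A : Set G.Point} (hA : G.IsMeasurable A) {e : E} {f : ℝ → ℝ}
    (hf : IntegrableOn f (Ioo 0 (G.len e))) :
    IntegrableOn (fun x => G.char A e x * f x) (Ioo 0 (G.len e)) := by
  refine Integrable.bdd_mul (c := 1) hf
    (G.integrableOn_char hA e _ (by simp)).aestronglyMeasurable (.of_forall fun x => ?_)
  unfold char
  exact (norm_indicator_le_norm_self _ _).trans (by simp)

/-- The function `c * u`. -/
def constMul (c : ℝ) (u : G.Fun) : G.Fun := fun e x => c * u e x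

variable [Fintype E]

theorem sum_integral_char_compl_mul [Fintype V] {A : Set G.Point} (hA : G.IsMeasurable A)
    {z z' : G.Fun} (hz : G.MemXK z z') :
    ∑ e, ∫ x in Ioo 0 (G.len e), G.char Aᶜ e x * z' e x =
      -∑ e, ∫ x in Ioo 0 (G.len e), G.char A e x * z' e x := by
  have hi : ∀ e, IntegrableOn (z' e) (Ioo 0 (G.len e)) := fun e =>
    integrableOn_of_memLp_two (hz.1 e).2.2.1
  refine Eq.trans ?_ ((congrArg (· - ∑ e, ∫ x in Ioo 0 (G.len e), G.char A e x * z' e x)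
    (G.sum_integral_deriv_eq_zero hz)).trans (zero_sub _))
  refine Eq.trans ?_ (Finset.sum_sub_distrib _ _)
  refine Finset.sum_congr rfl fun e _ => ?_
  refine Eq.trans ?_ (integral_sub (hi e) (integrableOn_char_mul hA (hi e)))
  refine setIntegral_congr_fun measurableSet_Ioo fun x hx => ?_
  simp only [G.char_compl A (Ioo_subset_Icc_self hx)]
  ring

theorem Per_compl [Fintype V] {A : Set G.Point} (hA : G.IsMeasurable A) :
    G.Per Aᶜ = G.Per A := by
  have := G.TV_congr (u := G.char Aᶜ) (v := G.char A) (c := -1) fun z z' hz => by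
    rw [sum_integral_char_compl_mul hA hz]; ring
  rwa [abs_neg, abs_one, ENNReal.ofReal_one, one_mul] at this

theorem TV_const_mul (u : G.Fun) (c : ℝ) :
    G.TV (constMul c u) = ENNReal.ofReal |c| * G.TV u := by
  refine G.TV_congr fun z z' _ => ?_
  rw [Finset.mul_sum]
  refine Finset.sum_congr rfl fun e _ => ?_
  rw [← integral_const_mul]
  simp only [constMul, mul_assoc]

theorem TV_cutFun [Fintype V] {A : Set G.Point} (hA : G.IsMeasurable A) :
    G.TV (G.cutFun A) = ENNReal.ofReal |2 / G.totalLength| * G.Per A := by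
  refine G.TV_congr fun z z' hz => ?_
  have hi : ∀ e, IntegrableOn (z' e) (Ioo 0 (G.len e)) := fun e =>
    integrableOn_of_memLp_two (hz.1 e).2.2.1
  have h1 : ∀ e, ∫ x in Ioo 0 (G.len e), G.cutFun A e x * z' e x = 1 / G.totalLength *
      ((∫ x in Ioo 0 (G.len e), G.char A e x * z' e x) -
        ∫ x in Ioo 0 (G.len e), G.char Aᶜ e x * z' e x) := fun e => by
    rw [← integral_sub (integrableOn_char_mul hA (hi e)) (integrableOn_char_mul hA.compl (hi e)),
      ← integral_const_mul]
    refine integral_congr_ae (.of_forall fun x => ?_)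
    simp only [cutFun]
    ring
  rw [Finset.sum_congr rfl fun e _ => h1 e, ← Finset.mul_sum, Finset.sum_sub_distrib,
    sum_integral_char_compl_mul hA hz]
  ring

theorem length_le_of_coordSet_subset {A B : Set G.Point}
    (h : ∀ e, G.coordSet A e ⊆ G.coordSet B e) : G.length A ≤ G.length B :=
  Finset.sum_le_sum fun e _ => measure_mono (h e)

theorem normL1_const_mul_char {A : Set G.Point} (hA : G.IsMeasurable A) (c : ℝ) :
    G.normL1 (constMul c (G.char A)) = ENNReal.ofReal |c| * G.length A := by
  unfold normL1 length
  rw [Finset.mul_sum]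
  refine Finset.sum_congr rfl fun e _ => ?_
  have h1 : constMul c (G.char A) e = c • G.char A e := rfl
  have h2 := (hA e).mono_ac (Measure.restrict_le_self (s := Icc 0 (G.len e))).absolutelyContinuous
  rw [h1, eLpNorm_const_smul, Real.enorm_eq_ofReal_abs, restrict_Ioo_eq_restrict_Icc]
  congr 1
  unfold char
  rw [eLpNorm_indicator_const₀ h2 one_ne_zero ENNReal.one_ne_top]
  simp [Measure.restrict_apply₀ h2, inter_eq_left.2 (G.coordSet_subset A e)]

theorem normalized_char_mem_admissible {D : Set G.Point} (hD : G.IsMeasurable D)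
    (h0 : G.length D ≠ 0) (hhalf : G.length D ≤ ENNReal.ofReal (G.totalLength / 2))
    (hPer : G.Per D ≠ ⊤) :
    constMul (G.length D).toReal⁻¹ (G.char D) ∈ G.admissible := by
  have hpos : 0 < (G.length D).toReal := ENNReal.toReal_pos h0 (G.length_ne_top D)
  refine ⟨G.memBV_of_TV_ne_top
    (fun e => (G.integrableOn_char hD e _ (by simp)).const_mul _) ?_, ?_, ?_, ?_⟩
  · rw [TV_const_mul]
    exact ENNReal.mul_ne_top ENNReal.ofReal_ne_top hPer
  · rw [normL1_const_mul_char hD, abs_of_pos (inv_pos.2 hpos), ENNReal.ofReal_inv_of_pos hpos,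
      ENNReal.ofReal_toReal (G.length_ne_top D), ENNReal.inv_mul_cancel h0 (G.length_ne_top D)]
  · have : G.length (G.sublevel (constMul (G.length D).toReal⁻¹ (G.char D)) 0) = 0 := by
      refine Finset.sum_eq_zero fun e _ => ?_
      rw [coordSet_sublevel]
      refine measure_mono_null (t := ∅) (fun x hx => ?_) measure_empty
      refine hx.2.not_ge (mul_nonneg (inv_pos.2 hpos).le ?_)
      exact indicator_nonneg (fun _ _ => zero_le_one) x
    rw [this]
    exact zero_le
  · refine le_trans (length_le_of_coordSet_subset fun e x hx => ?_) hhalf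
    rw [coordSet_superlevel] at hx
    by_contra hxD
    have h1 : G.char D e x = 0 := indicator_of_notMem hxD _
    have h2 := hx.2
    rw [constMul, h1, mul_zero] at h2
    exact lt_irrefl _ h2

theorem lambda1_le_Per_div_length {D : Set G.Point} (hD : G.IsMeasurable D)
    (h0 : G.length D ≠ 0) (hhalf : G.length D ≤ ENNReal.ofReal (G.totalLength / 2)) :
    G.lambda1 ≤ G.Per D / G.length D := by
  -- Finite perimeter is what makes χ_D a BV function; otherwise the bound is trivial.
  rcases eq_or_ne (G.Per D) ⊤ with htop | htop
  · rw [htop, ENNReal.top_div_of_ne_top (G.length_ne_top D)]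
    exact le_top
  · refine (iInf₂_le _ (normalized_char_mem_admissible hD h0 hhalf htop)).trans (le_of_eq ?_)
    have hpos : 0 < (G.length D).toReal := ENNReal.toReal_pos h0 (G.length_ne_top D)
    rw [TV_const_mul, abs_of_pos (inv_pos.2 hpos), ENNReal.ofReal_inv_of_pos hpos,
      ENNReal.ofReal_toReal (G.length_ne_top D), mul_comm, ENNReal.div_eq_inv_mul, mul_comm]
    rfl

theorem lambda1_le_cheeger [Fintype V] : G.lambda1 ≤ G.cheeger := by
  refine le_iInf fun D => le_iInf fun hD => le_iInf fun h0 => le_iInf fun hlt => ?_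
  have hadd := G.length_add_length_compl hD
  have hℓ : 0 ≤ G.totalLength := Finset.sum_nonneg fun e _ => (G.len_pos e).le
  have hsplit : ENNReal.ofReal G.totalLength =
      ENNReal.ofReal (G.totalLength / 2) + ENNReal.ofReal (G.totalLength / 2) := by
    rw [← ENNReal.ofReal_add (by linarith) (by linarith), add_halves]
  have h1 : G.length Dᶜ ≠ 0 := by
    intro h
    rw [h, add_zero] at hadd
    exact hlt.ne hadd
  rcases le_total (G.length D) (G.length Dᶜ) with hle | hle
  -- The smaller of D and its complement has at most half of the total length, since the two lengths
  -- add up to it.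
  · rw [min_eq_left hle]
    refine lambda1_le_Per_div_length hD h0.ne' (not_lt.1 fun hlt' => ?_)
    exact absurd (hadd.trans hsplit) (ENNReal.add_lt_add hlt' (hlt'.trans_le hle)).ne'
  · rw [min_eq_right hle, ← Per_compl hD]
    refine lambda1_le_Per_div_length hD.compl h1 (not_lt.1 fun hlt' => ?_)
    exact absurd (hadd.trans hsplit) (ENNReal.add_lt_add (hlt'.trans_le hle) hlt').ne'

theorem cutFun_apply (A : Set G.Point) {e : E} {x : ℝ} (hx : x ∈ Icc 0 (G.len e)) :
    (x ∈ G.coordSet A e ∧ G.cutFun A e x = 1 / G.totalLength) ∨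
      (x ∈ G.coordSet Aᶜ e ∧ G.cutFun A e x = -(1 / G.totalLength)) := by
  simp only [cutFun, G.char_compl A hx, G.coordSet_compl]
  by_cases h : x ∈ G.coordSet A e
  · have : G.char A e x = 1 := indicator_of_mem h _
    exact .inl ⟨h, by rw [this]; ring⟩
  · have : G.char A e x = 0 := indicator_of_notMem h _
    exact .inr ⟨⟨hx, h⟩, by rw [this]; ring⟩

theorem normL1_cutFun [Nonempty E] (A : Set G.Point) : G.normL1 (G.cutFun A) = 1 := by
  have hℓ := G.totalLength_pos
  have h : ∀ e, eLpNorm (G.cutFun A e) 1 (volume.restrict (Ioo 0 (G.len e))) =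
      ENNReal.ofReal (1 / G.totalLength) * ENNReal.ofReal (G.len e) := fun e => by
    have h1 : ∀ᵐ x ∂(volume.restrict (Ioo 0 (G.len e))),
        ‖G.cutFun A e x‖ = ‖1 / G.totalLength‖ := by
      refine (ae_restrict_mem measurableSet_Ioo).mono fun x hx => ?_
      rcases cutFun_apply A (Ioo_subset_Icc_self hx) with h | h
      · rw [h.2]
      · rw [h.2, norm_neg]
    rw [eLpNorm_congr_norm_ae h1, eLpNorm_const _ one_ne_zero (by simp [G.len_pos e]),
      Real.enorm_eq_ofReal_abs, abs_of_pos (by positivity)]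
    simp
  unfold normL1
  rw [Finset.sum_congr rfl fun e _ => h e, ← Finset.mul_sum,
    ← ENNReal.ofReal_sum_of_nonneg fun e _ => (G.len_pos e).le,
    ← ENNReal.ofReal_mul (by positivity)]
  change ENNReal.ofReal (1 / G.totalLength * G.totalLength) = 1
  rw [one_div_mul_cancel hℓ.ne', ENNReal.ofReal_one]

theorem cutFun_mem_admissible [Nonempty E] {A : Set G.Point} (hA : G.IsMeasurable A)
    (hhalf : G.length A = ENNReal.ofReal (G.totalLength / 2)) (hTV : G.TV (G.cutFun A) ≠ ⊤) :
    G.cutFun A ∈ G.admissible := by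
  have hℓ := G.totalLength_pos
  have hinv : 0 < 1 / G.totalLength := by positivity
  have hcompl : G.length Aᶜ = ENNReal.ofReal (G.totalLength / 2) := by
    have h := G.length_add_length_compl hA
    rw [hhalf, ← add_halves G.totalLength, ENNReal.ofReal_add (by linarith) (by linarith),
      add_halves] at h
    exact (ENNReal.add_right_inj ENNReal.ofReal_ne_top).1 h
  refine ⟨G.memBV_of_TV_ne_top (fun e => ?_) hTV, normL1_cutFun A, ?_, ?_⟩
  · exact ((G.integrableOn_char hA e _ (by simp)).sub
      (G.integrableOn_char hA.compl e _ (by simp))).const_mul _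
  · refine (length_le_of_coordSet_subset fun e x hx => ?_).trans hcompl.le
    rw [coordSet_sublevel] at hx
    rcases cutFun_apply A (Ioo_subset_Icc_self hx.1) with h | h
    · exact absurd (h.2 ▸ hx.2) hinv.le.not_gt
    · exact h.1
  · refine (length_le_of_coordSet_subset fun e x hx => ?_).trans hhalf.le
    rw [coordSet_superlevel] at hx
    rcases cutFun_apply A (Ioo_subset_Icc_self hx.1) with h | h
    · exact h.1
    · exact absurd (h.2 ▸ hx.2) (neg_nonpos.2 hinv.le).not_gt

end MetricGraph

end

theorem mainTheorem12 {V E : Type*} [Fintype V] [Fintype E] [Nonempty E] (G : MetricGraph V E)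
    (A : Set G.Point) (hmeas : G.IsMeasurable A)
    (hA : G.length A = ENNReal.ofReal (G.totalLength / 2)) :
    G.cheeger = G.Per A / G.length A ↔ G.IsMinimizer (G.cutFun A) := by
  have hℓ := G.totalLength_pos
  have hTV : G.TV (G.cutFun A) = G.Per A / G.length A := by
    rw [MetricGraph.TV_cutFun hmeas, abs_of_pos (by positivity), hA, ENNReal.div_eq_inv_mul,
      ← ENNReal.ofReal_inv_of_pos (by positivity), inv_div]
  have hle : G.cheeger ≤ G.lambda1 := le_iInf₂ fun u hu => MetricGraph.cheeger_le_TV hu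
  have heq : G.lambda1 = G.cheeger := le_antisymm MetricGraph.lambda1_le_cheeger hle
  rw [← hTV, MetricGraph.IsMinimizer, heq]
  constructor
  · intro h
    -- Equality with the finite number h makes the total variation of the cut function finite, hence
    -- the function BV.
    exact ⟨MetricGraph.cutFun_mem_admissible hmeas hA (h ▸ MetricGraph.cheeger_ne_top), h.symm⟩
  · exact fun h => h.2.symm
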